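/- Let $\bar s\in(0,+\infty]$, $\mu\in\mathbb R$ (the depreciation rate; $\mu>0$ in the model), $\rho>0$ (the discount rate), $q_0,\beta_0\in\mathbb R$, and let $\alpha,q_1,\beta_1$ be real functions of the age $s$. Elements of $H^1$ are identified with their continuous representatives. Assume: 1. $\alpha,q_1\in H^1(0,\bar s)$; moreover $\beta_1\in H^1(0,\bar s)$ if $\bar s<\infty$, and $\beta_1\in H^1(0,L)$ for every finite $L$ if $\bar s=\infty$; 2. $\alpha\ge0$, $q_1\ge 0$ and $\beta_1\ge\epsilon$ for some constant $\epsilon>0$; 3. the weak derivatives satisfy $\alpha'\le0$, $q_1'\le 0$, $\beta_1'\le0$ a.e.; 4. $\alpha(\bar s)=0$ if $\bar s<\infty$ (if $\bar s=\infty$, $\alpha$ vanishes at infinity automatically), $q_0\ge q_1(0^+)$ and $\beta_0\ge\beta_1(0^+)$; 5. if $\bar s=+\infty$, then $\rho>-\mu$. Let $X=L^2(0,\bar s)$ and $U=\mathbb R\times X$ with $|(u_0,u_1)|=|u_0|+|u_1|_X$. Let $A f=-f'-\mu f$ on $D(A)=\{f\in H^1(0,\bar s): f(0)=0\}$, which generates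 the $C_0$-semigroup $[e^{tA}f](s)=e^{-\mu t}f(s-t)\chi_{[t,\bar s]}(s)$ on $X$. Its adjoint semigroup is $[e^{tA^*}f](s)=e^{-\mu t}f(s+t)\chi_{[0,\bar s-t]}(s)$, with $D(A^*)=\{f\in H^1(0,\bar s): f(\bar s)=0\}$ (and $D(A^*)=H^1(0,\infty)$ if $\bar s=\infty$). For an initial datum $z_0=x\in X$ and a control $u=(u_0,u_1)\in L^2_\rho(0,\infty;U)$, i.e. $u$ measurable with $\int_0^\infty e^{-\rho t}|u(t)|^2dt<\infty$, let $y=y^{x,u}\in C([0,\infty);X)$, $y(t)=z(t,\cdot)$, be the mild solution of $$\partial_t z+\partial_s z=-\mu z+u_1,\qquad z(t,0)=u_0(t),\qquad z(0,s)=z_0(s),$$ that is, $y(t)=e^{tA}x+\int_0^te^{(t-\tau)A}\big(u_0(\tau)\delta_0+u_1(\tau)\big)d\tau$ in $D(A^*)'$ for all $t\ge0$, where $e^{tA}$ is extended to $D(A^*)'$ as the transpose of $e^{tA^*}|_{D(A^*)}$. Put $$J(x;u)=\int_0^\infty e^{-\rho t}\Big[\int_0^{\bar s}\big(\alpha\,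 y(t)-q_1u_1(t)-\beta_1u_1(t)^2\big)ds-q_0u_0(t)-\beta_0u_0(t)^2\Big]dt,\qquad V(x)=\sup_{u\in L^2_\rho(0,\infty;U)}J(x;u).$$ Define $\bar\alpha(s)=\int_s^{\bar s}e^{-(\rho+\mu)(\sigma-s)}\alpha(\sigma)\,d\sigma$ and $$v(x)=\langle\bar\alpha,x\rangle+\frac{(\bar\alpha(0)-q_0)^2}{4\rho\beta_0}+\int_0^{\bar s}\frac{(\bar\alpha(s)-q_1(s))^2}{4\rho\beta_1(s)}\,ds .$$ **Theorem.** For every $x=z_0\in X$ and every admissible control $u$ the mild solution $y^{x,u}$ exists and is unique, and $J(x;u)$ is well defined and finite. Moreover: (i) $V(x)=v(x)$ for every $x\in X$. (ii) For every $x=z_0\in X$ the time-independent control $$u_0^*=\frac{\bar\alpha(0)-q_0}{2\beta_0},\qquad u_1^*(s)=\frac{\bar\alpha(s)-q_1(s)}{2\beta_1(s)}$$ (where $u_1^*\in X$) is optimal, every optimal control equals it for a.e. $t>0$, and the associated optimal trajectory is, for every $t\ge0$ and a.e. $s\in(0,\bar s)$, $$z^*(t,s)=\begin{cases}\displaystyle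 e^{-\mu t}z_0(s-t)+\int_0^te^{-\mu\sigma}\,\frac{\bar\alpha(s-\sigma)-q_1(s-\sigma)}{2\beta_1(s-\sigma)}\,d\sigma,& s\ge t,\\[2mm]\displaystyle e^{-\mu s}\,\frac{\bar\alpha(0)-q_0}{2\beta_0}+\int_0^se^{-\mu\sigma}\,\frac{\bar\alpha(s-\sigma)-q_1(s-\sigma)}{2\beta_1(s-\sigma)}\,d\sigma,& s<t.\end{cases}$$ -/

import Mathlib

open MeasureTheory Set

noncomputable section

namespace VintageCapital

/-- Lebesgue measure on the age interval `(0, sbar)`, where `sbar` may be `+∞`. -/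
def ageMeasure (sbar : EReal) : Measure ℝ :=
  volume.restrict {s : ℝ | 0 < s ∧ (s : EReal) < sbar}

/-- The state space `X = L²(0, sbar)`. -/
abbrev State (sbar : EReal) : Type := Lp ℝ 2 (ageMeasure sbar)

/-- `f` is the continuous representative, on the closed age interval `[0, sbar]` (on `[0, ∞)` if
`sbar = ∞`), of an element of `H¹(0, sbar)` whose weak derivative is `g`: both functions are in
`L²(0, sbar)` and `f` is a primitive of `g`. In particular `f 0` is the limit of `f` at `0+`. -/
def HasH1Deriv (sbar : EReal) (f g : ℝ → ℝ) : Prop :=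
  MemLp f 2 (ageMeasure sbar) ∧ MemLp g 2 (ageMeasure sbar) ∧
    ∀ s : ℝ, 0 ≤ s → (s : EReal) ≤ sbar → f s = f 0 + ∫ σ in (0 : ℝ)..s, g σ

/-- The condition `f(sbar) = 0`. It is void for `sbar = ∞`, where every function of `H¹(0, ∞)`
tends to zero at infinity. -/
def VanishesAtEnd (sbar : EReal) (f : ℝ → ℝ) : Prop :=
  ∀ L : ℝ, (L : EReal) = sbar → f L = 0

/-- The domain `D(A*) = {φ ∈ H¹(0, sbar) : φ(sbar) = 0}` of the adjoint of
`A f = - f' - mu f`, `D(A) = {f ∈ H¹(0, sbar) : f(0) = 0}`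
(its elements are given by their continuous representatives). -/
def DomAdjoint (sbar : EReal) (φ : ℝ → ℝ) : Prop :=
  (∃ g, HasH1Deriv sbar φ g) ∧ VanishesAtEnd sbar φ

/-- The adjoint semigroup `(e^{tA*} φ)(s) = e^{-mu t} φ(s + t) χ_{[0, sbar - t]}(s)`. -/
def adjointSemigroup (sbar : EReal) (mu t : ℝ) (φ : ℝ → ℝ) (s : ℝ) : ℝ :=
  open Classical in
  if ((s + t : ℝ) : EReal) ≤ sbar then Real.exp (-mu * t) * φ (s + t) else 0

/-- The control operator `B (u₀, u₁) = u₀ δ₀ + u₁` with values in `D(A*)'`, evaluated at `ψ`. -/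
def controlOp (sbar : EReal) (u : ℝ × State sbar) (ψ : ℝ → ℝ) : ℝ :=
  u.1 * ψ 0 + ∫ s, u.2 s * ψ s ∂(ageMeasure sbar)

/-- `y ∈ C([0, ∞); X)` is the mild solution of `y' = A y + B u`, `y(0) = x`, that is,
`y(t) = e^{tA} x + ∫₀ᵗ e^{(t - τ)A} B u(τ) dτ` in `D(A*)'` for all `t ≥ 0`. The extended semigroup
on `D(A*)'` is the transpose of the adjoint semigroup on `D(A*)`: the equation is written out by
evaluating both sides at the elements `φ` of `D(A*)`. -/
def IsMildSolution (sbar : EReal) (mu : ℝ) (x : State sbar) (u : ℝ → ℝ × State sbar)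
    (y : ℝ → State sbar) : Prop :=
  ContinuousOn y (Ici 0) ∧
    ∀ t : ℝ, 0 ≤ t → ∀ φ : ℝ → ℝ, DomAdjoint sbar φ →
      ∫ s, y t s * φ s ∂(ageMeasure sbar) =
        (∫ s, x s * adjointSemigroup sbar mu t φ s ∂(ageMeasure sbar)) +
          ∫ τ in (0 : ℝ)..t, controlOp sbar (u τ) (adjointSemigroup sbar mu (t - τ) φ)

/-- The admissible controls `u = (u₀, u₁) ∈ L²_ρ(0, ∞; ℝ × X)`, with `|u| = |u₀| + |u₁|`. -/
def Admissible (sbar : EReal) (ρ : ℝ) (u : ℝ → ℝ × State sbar) : Prop :=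
  AEStronglyMeasurable u (volume.restrict (Ioi (0 : ℝ))) ∧
    IntegrableOn (fun t => Real.exp (-ρ * t) * (|(u t).1| + ‖(u t).2‖) ^ 2) (Ioi (0 : ℝ))

/-- The data of the control problem that enter the profit. -/
structure Coeffs where
  ρ : ℝ
  q0 : ℝ
  β0 : ℝ
  α : ℝ → ℝ
  q1 : ℝ → ℝ
  β1 : ℝ → ℝ

/-- The profit density at age `s`, in state `x` and with the control `w` in used capital goods. -/
def profitDensity {sbar : EReal} (c : Coeffs) (x w : State sbar) (s : ℝ) : ℝ :=
  c.α s * x s - c.q1 s * w s - c.β1 s * (w s) ^ 2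

/-- The instantaneous profit in state `x` with the control `u`. -/
def profitRate {sbar : EReal} (c : Coeffs) (x : State sbar) (u : ℝ × State sbar) : ℝ :=
  (∫ s, profitDensity c x u.2 s ∂(ageMeasure sbar)) - c.q0 * u.1 - c.β0 * u.1 ^ 2

/-- The discounted intertemporal profit of a trajectory `y` and a control `u`. -/
def payoff {sbar : EReal} (c : Coeffs) (y : ℝ → State sbar) (u : ℝ → ℝ × State sbar) : ℝ :=
  ∫ t in Ioi (0 : ℝ), Real.exp (-c.ρ * t) * profitRate c (y t) (u t)

/-- The integrals in the discounted profit converge. -/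
def PayoffFinite {sbar : EReal} (c : Coeffs) (y : ℝ → State sbar) (u : ℝ → ℝ × State sbar) :
    Prop :=
  (∀ t : ℝ, 0 ≤ t → Integrable (profitDensity c (y t) (u t).2) (ageMeasure sbar)) ∧
    IntegrableOn (fun t => Real.exp (-c.ρ * t) * profitRate c (y t) (u t)) (Ioi (0 : ℝ))

/-- The value function: the supremum, in `[-∞, ∞]`, of the profit over the admissible controls. -/
def valueFunction (sbar : EReal) (mu : ℝ) (c : Coeffs) (x : State sbar) : EReal :=
  sSup {r : EReal | ∃ u y, Admissible sbar c.ρ u ∧ IsMildSolution sbar mu x u y ∧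
    r = ((payoff c y u : ℝ) : EReal)}

/-- The control `u` is optimal at the initial state `x`. -/
def IsOptimal (sbar : EReal) (mu : ℝ) (c : Coeffs) (x : State sbar) (u : ℝ → ℝ × State sbar) :
    Prop :=
  Admissible sbar c.ρ u ∧ ∃ y, IsMildSolution sbar mu x u y ∧
    ((payoff c y u : ℝ) : EReal) = valueFunction sbar mu c x

/-- The assumptions on the coefficients. The age derivatives are weak derivatives. For
`sbar < ∞` the condition on `β1` is `β1 ∈ H¹(0, sbar)`; for `sbar = ∞` it is
`β1 ∈ H¹(0, L)` for all finite `L`, as a function bounded below by `ε > 0` is never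
in `L²(0, ∞)`. -/
structure CoeffAssumption (sbar : EReal) (c : Coeffs) : Prop where
  alpha_mem : ∃ g, HasH1Deriv sbar c.α g ∧ ∀ᵐ s ∂(ageMeasure sbar), g s ≤ 0
  q1_mem : ∃ g, HasH1Deriv sbar c.q1 g ∧ ∀ᵐ s ∂(ageMeasure sbar), g s ≤ 0
  beta1_mem : ∃ g, (∀ L : ℝ, 0 < L → (L : EReal) ≤ sbar → HasH1Deriv (L : EReal) c.β1 g) ∧
    ∀ᵐ s ∂(ageMeasure sbar), g s ≤ 0
  alpha_nonneg : ∀ s : ℝ, 0 ≤ s → (s : EReal) ≤ sbar → 0 ≤ c.α s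
  q1_nonneg : ∀ s : ℝ, 0 ≤ s → (s : EReal) ≤ sbar → 0 ≤ c.q1 s
  beta1_bound : ∃ ε : ℝ, 0 < ε ∧ ∀ s : ℝ, 0 ≤ s → (s : EReal) ≤ sbar → ε ≤ c.β1 s
  alpha_end : VanishesAtEnd sbar c.α
  q0_ge : c.q1 0 ≤ c.q0
  beta0_ge : c.β1 0 ≤ c.β0

/-- `ᾱ(s) = ∫_s^sbar e^{-(ρ + mu)(σ - s)} α(σ) dσ`. -/
def alphaBar (sbar : EReal) (mu : ℝ) (c : Coeffs) (s : ℝ) : ℝ :=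
  ∫ σ in {σ : ℝ | s < σ ∧ (σ : EReal) < sbar}, Real.exp (-(c.ρ + mu) * (σ - s)) * c.α σ

/-- The explicit function `v`. -/
def explicitValue (sbar : EReal) (mu : ℝ) (c : Coeffs) (x : State sbar) : ℝ :=
  (∫ s, alphaBar sbar mu c s * x s ∂(ageMeasure sbar)) +
    (alphaBar sbar mu c 0 - c.q0) ^ 2 / (4 * c.ρ * c.β0) +
    ∫ s, (alphaBar sbar mu c s - c.q1 s) ^ 2 / (4 * c.ρ * c.β1 s) ∂(ageMeasure sbar)

/-- `u₀* = (ᾱ(0) - q₀) / (2 β₀)`. -/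
def optBoundary (sbar : EReal) (mu : ℝ) (c : Coeffs) : ℝ :=
  (alphaBar sbar mu c 0 - c.q0) / (2 * c.β0)

/-- `u₁*(s) = (ᾱ(s) - q₁(s)) / (2 β₁(s))`. -/
def optDistributed (sbar : EReal) (mu : ℝ) (c : Coeffs) (s : ℝ) : ℝ :=
  (alphaBar sbar mu c s - c.q1 s) / (2 * c.β1 s)

/-- The explicit trajectory `z*(t, s)` with initial datum `z0`. -/
def optTrajectory (sbar : EReal) (mu : ℝ) (c : Coeffs) (z0 : ℝ → ℝ) (t s : ℝ) : ℝ :=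
  if t ≤ s then
    Real.exp (-mu * t) * z0 (s - t) +
      ∫ σ in (0 : ℝ)..t, Real.exp (-mu * σ) * optDistributed sbar mu c (s - σ)
  else
    Real.exp (-mu * s) * optBoundary sbar mu c +
      ∫ σ in (0 : ℝ)..s, Real.exp (-mu * σ) * optDistributed sbar mu c (s - σ)

end VintageCapital

end

noncomputable section

namespace VintageCapital

open Filter Topology

/-! The payoff can be computed exactly, by duality and a completed square; no
Hamilton–Jacobi–Bellman equation is solved and no growth estimate on the trajectory is needed.

Test the mild equation with `φ = α`, which lies in D(A*), and multiply by e^{-ρt}. Since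
e^{-ρt}e^{-μ(t-τ)} = e^{-ρτ}e^{-(ρ+μ)(t-τ)}, the contribution of the control becomes the convolution
of the discounted control with the discounted adjoint orbit K(r) of α (`discounted_revenue_eq`).
Both factors are in L¹, so the convolution is integrable and its integral is the pairing of the
integrals (`integral_discounted_revenue`). As ∫K = (ᾱ(0), ᾱ), the discounted revenue equals ⟨x, ᾱ⟩
plus the discounted pairing of u(t) with this fixed vector of shadow prices.

What remains is, at each time separately, a concave quadratic function of u(t) whose maximiser does
not depend on t or on the state. Completing the square (`profitRate_eq`) gives J(x;u) = v(x) - ∫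
e^{-ρt} loss(u(t)) dt (`ProblemData.payoff_eq`), with a nonnegative loss that vanishes only at (u₀*,
u₁*), because β₀ and β₁ are bounded below by ε > 0. The value function, optimality and uniqueness of
the control all follow.

Mild solutions are built in L²(ℝ), where translations form a unitary group: the boundary datum is
encoded as an initial profile at negative ages, the whole is translated by t, restricted to (0,
sbar) and damped. They are unique because D(A*) contains the test functions on the age interval. -/

/-- The age interval `(0, sbar)`. -/
def ageSet (sbar : EReal) : Set ℝ := {s : ℝ | 0 < s ∧ (s : EReal) < sbar}

lemma isOpen_ageSet (sbar : EReal) : IsOpen (ageSet sbar) :=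
  isOpen_Ioi.inter (isOpen_Iio.preimage continuous_coe_real_ereal)

lemma measurableSet_ageSet (sbar : EReal) : MeasurableSet (ageSet sbar) :=
  (isOpen_ageSet sbar).measurableSet

lemma ageMeasure_eq (sbar : EReal) : ageMeasure sbar = volume.restrict (ageSet sbar) := rfl

instance (sbar : EReal) : SigmaFinite (ageMeasure sbar) := by
  rw [ageMeasure_eq]; infer_instance

instance (sbar : EReal) : IsLocallyFiniteMeasure (ageMeasure sbar) := by
  rw [ageMeasure_eq]; infer_instance

/-! ### Translations of `L²(ℝ)` and of `L²(0, sbar)` -/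

/-- The right translation `f ↦ f (· - t)` of `L²(ℝ)`. -/
def translate (t : ℝ) : Lp ℝ 2 (volume : Measure ℝ) →L[ℝ] Lp ℝ 2 (volume : Measure ℝ) :=
  (Lp.compMeasurePreservingₗᵢ ℝ (fun s : ℝ => s - t)
    (measurePreserving_sub_right volume t)).toContinuousLinearMap

lemma translate_coeFn (t : ℝ) (f : Lp ℝ 2 (volume : Measure ℝ)) :
    translate t f =ᵐ[volume] fun s => f (s - t) :=
  Lp.coeFn_compMeasurePreserving f (measurePreserving_sub_right volume t)

lemma norm_translate (t : ℝ) (f : Lp ℝ 2 (volume : Measure ℝ)) : ‖translate t f‖ = ‖f‖ :=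
  Lp.norm_compMeasurePreserving f (measurePreserving_sub_right volume t)

/-- Joint continuity is what is needed: in the trajectory and in the Duhamel integrand both the
shift and the shifted function vary with time. -/
lemma continuous_translate :
    Continuous fun p : ℝ × Lp ℝ 2 (volume : Measure ℝ) => translate p.1 p.2 := by
  have h : Continuous fun p : ℝ × Lp ℝ 2 (volume : Measure ℝ) =>
      ContinuousMap.curry (⟨fun q : (ℝ × Lp ℝ 2 (volume : Measure ℝ)) × ℝ => q.2 - q.1.1,
        by fun_prop⟩ : C((ℝ × Lp ℝ 2 (volume : Measure ℝ)) × ℝ, ℝ)) p :=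
    ContinuousMap.continuous _
  exact Continuous.compMeasurePreservingLp (p := 2) continuous_snd h
    (fun z => measurePreserving_sub_right volume z.1) (by simp)

lemma inner_translate (t : ℝ) (f g : Lp ℝ 2 (volume : Measure ℝ)) :
    inner ℝ (translate t f) g = inner ℝ f (translate (-t) g) := by
  rw [L2.inner_def, L2.inner_def, 
    ← integral_sub_right_eq_self (fun s => inner ℝ (f s) (translate (-t) g s)) t]
  refine integral_congr_ae ?_
  have h := (measurePreserving_sub_right (volume : Measure ℝ) t).quasiMeasurePreserving.ae
    (translate_coeFn (-t) g)
  filter_upwards [translate_coeFn t f, h] with s hs hs'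
  rw [hs, hs']
  simp

lemma translate_translate (s t : ℝ) (f : Lp ℝ 2 (volume : Measure ℝ)) :
    translate s (translate t f) = translate (s + t) f := by
  apply Lp.ext
  have h := (measurePreserving_sub_right (volume : Measure ℝ) s).quasiMeasurePreserving.ae
    (translate_coeFn t f)
  filter_upwards [translate_coeFn s (translate t f), translate_coeFn (s + t) f, h] with r h1 h2 h3
  rw [h1, h2, h3, sub_sub]

lemma memLp_indicator_ageSet {sbar : EReal} (x : State sbar) :
    MemLp ((ageSet sbar).indicator x) 2 volume :=
  (memLp_indicator_iff_restrict (measurableSet_ageSet sbar)).2 (Lp.memLp x)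

/-- Extension by zero from `L²(0, sbar)` to `L²(ℝ)`. -/
def extend (sbar : EReal) : State sbar →L[ℝ] Lp ℝ 2 (volume : Measure ℝ) :=
  LinearMap.mkContinuous
    { toFun := fun x => (memLp_indicator_ageSet x).toLp
      map_add' := fun x y => by
        rw [← MemLp.toLp_add]
        refine MemLp.toLp_congr _ _ ?_
        have := (ae_restrict_iff' (measurableSet_ageSet sbar)).1 (Lp.coeFn_add x y)
        filter_upwards [this] with s hs
        by_cases h : s ∈ ageSet sbar
        · simpa [h] using hs h
        · simp [h]
      map_smul' := fun a x => by
        rw [RingHom.id_apply, ← MemLp.toLp_const_smul]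
        refine MemLp.toLp_congr _ _ ?_
        have := (ae_restrict_iff' (measurableSet_ageSet sbar)).1 (Lp.coeFn_smul a x)
        filter_upwards [this] with s hs
        by_cases h : s ∈ ageSet sbar
        · simpa [h] using hs h
        · simp [h] }
    1 fun x => by
      simp only [LinearMap.coe_mk, AddHom.coe_mk, Lp.norm_toLp, one_mul]
      rw [eLpNorm_indicator_eq_eLpNorm_restrict (measurableSet_ageSet sbar), Lp.norm_def]
      rfl

lemma extend_coeFn {sbar : EReal} (x : State sbar) :
    extend sbar x =ᵐ[volume] (ageSet sbar).indicator x :=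
  (memLp_indicator_ageSet x).coeFn_toLp

lemma norm_extend_le {sbar : EReal} (x : State sbar) : ‖extend sbar x‖ ≤ ‖x‖ :=
  (ContinuousLinearMap.le_of_opNorm_le (extend sbar)
    (LinearMap.mkContinuous_norm_le _ zero_le_one _) x).trans_eq (one_mul _)

/-- Restriction from `L²(ℝ)` to `L²(0, sbar)`. -/
def restrictAge (sbar : EReal) : Lp ℝ 2 (volume : Measure ℝ) →L[ℝ] State sbar :=
  LpToLpRestrictCLM ℝ ℝ ℝ volume 2 (ageSet sbar)

lemma restrictAge_coeFn (sbar : EReal) (f : Lp ℝ 2 (volume : Measure ℝ)) :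
    restrictAge sbar f =ᵐ[ageMeasure sbar] f :=
  LpToLpRestrictCLM_coeFn ℝ (ageSet sbar) f

lemma norm_restrictAge_le (sbar : EReal) (f : Lp ℝ 2 (volume : Measure ℝ)) :
    ‖restrictAge sbar f‖ ≤ ‖f‖ := by
  rw [Lp.norm_def, Lp.norm_def]
  refine ENNReal.toReal_mono (Lp.eLpNorm_ne_top f) ?_
  rw [eLpNorm_congr_ae (restrictAge_coeFn sbar f)]
  exact eLpNorm_mono_measure _ Measure.restrict_le_self

/-- Restriction and extension by zero are adjoint. Together with `inner_translate` this moves the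
semigroup onto the test function and plays the role of the abstract transpose. -/
lemma inner_restrictAge {sbar : EReal} (f : Lp ℝ 2 (volume : Measure ℝ)) (x : State sbar) :
    inner ℝ (restrictAge sbar f) x = inner ℝ f (extend sbar x) := by
  rw [L2.inner_def, L2.inner_def]
  refine (integral_indicator (measurableSet_ageSet sbar)).symm.trans ?_
  refine integral_congr_ae ?_
  have h := (ae_restrict_iff' (measurableSet_ageSet sbar)).1 (restrictAge_coeFn sbar f)
  filter_upwards [h, extend_coeFn x] with s h1 h2
  by_cases hs : s ∈ ageSet sbar
  · simp [hs, h1 hs, h2]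
  · simp [hs, h2]

attribute [irreducible] translate extend restrictAge

/-- The shift `x ↦ x (· - t)` of `L²(0, sbar)`, where `x` is extended by zero; `t` may have
either sign. -/
def ageShift (sbar : EReal) (t : ℝ) : State sbar →L[ℝ] State sbar :=
  restrictAge sbar ∘L translate t ∘L extend sbar

lemma ageShift_apply {sbar : EReal} (t : ℝ) (x : State sbar) :
    ageShift sbar t x = restrictAge sbar (translate t (extend sbar x)) := rfl

lemma continuous_ageShift (sbar : EReal) :
    Continuous fun p : ℝ × State sbar => ageShift sbar p.1 p.2 :=
  (restrictAge sbar).continuous.comp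
    (continuous_translate.comp (continuous_fst.prodMk ((extend sbar).continuous.comp continuous_snd)))

lemma norm_ageShift_le {sbar : EReal} (t : ℝ) (x : State sbar) : ‖ageShift sbar t x‖ ≤ ‖x‖ :=
  (norm_restrictAge_le sbar _).trans ((norm_translate t _).le.trans (norm_extend_le x))

lemma ageShift_coeFn {sbar : EReal} (t : ℝ) (x : State sbar) :
    ageShift sbar t x =ᵐ[ageMeasure sbar] fun s => (ageSet sbar).indicator x (s - t) := by
  have h1 := ae_restrict_of_ae (s := ageSet sbar) (translate_coeFn t (extend sbar x))
  have h2 := ae_restrict_of_ae (s := ageSet sbar)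
    ((measurePreserving_sub_right (volume : Measure ℝ) t).quasiMeasurePreserving.ae (extend_coeFn x))
  filter_upwards [restrictAge_coeFn sbar (translate t (extend sbar x)), h1, h2] with s h0 h1 h2
  rw [ageShift_apply, h0, h1, h2]

attribute [irreducible] ageShift

/-- The shift of the class of a function. -/
lemma ageShift_toLp_coeFn {sbar : EReal} (t : ℝ) {f : ℝ → ℝ} (hf : MemLp f 2 (ageMeasure sbar)) :
    ageShift sbar t hf.toLp =ᵐ[ageMeasure sbar] fun s => (ageSet sbar).indicator f (s - t) := by
  have h1 : (ageSet sbar).indicator hf.toLp =ᵐ[volume] (ageSet sbar).indicator f := by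
    have := (ae_restrict_iff' (measurableSet_ageSet sbar)).1 hf.coeFn_toLp
    filter_upwards [this] with s hs
    by_cases h : s ∈ ageSet sbar <;> simp [h, hs]
  have h2 := ae_restrict_of_ae (s := ageSet sbar)
    ((measurePreserving_sub_right (volume : Measure ℝ) t).quasiMeasurePreserving.ae h1)
  filter_upwards [ageShift_coeFn t hf.toLp, h2] with s h1 h2
  rw [h1, h2]

/-- A Bochner integral of `L²` functions is given by the pointwise integrals. -/
lemma coeFn_integral_Lp {m ν : Measure ℝ} [SigmaFinite m] [SFinite ν] {G : ℝ → Lp ℝ 2 m}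
    (hG : Integrable G ν) {g : ℝ → ℝ → ℝ}
    (hg : AEStronglyMeasurable (fun p : ℝ × ℝ => g p.1 p.2) (ν.prod m))
    (h : ∀ᵐ r ∂ν, G r =ᵐ[m] g r) :
    (∫ r, G r ∂ν : Lp ℝ 2 m) =ᵐ[m] fun s => ∫ r, g r s ∂ν := by
  -- Fubini needs joint integrability only over sets A of finite measure, where Cauchy–Schwarz gives
  -- ∫_A |G r| = ⟨1_A, |G r|⟩ ≤ ‖1_A‖ ‖G r‖, integrable in r.
  have key : ∀ A, MeasurableSet A → m A < ⊤ →
      Integrable (fun p : ℝ × ℝ => g p.1 p.2) (ν.prod (m.restrict A)) := by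
    intro A hA hmA
    have hle : ν.prod (m.restrict A) ≤ ν.prod m :=
      Measure.prod_mono le_rfl Measure.restrict_le_self
    have : IsFiniteMeasure (m.restrict A) := ⟨by simpa using hmA⟩
    have hmeas := hg.mono_measure hle
    have hfin : ∀ f : Lp ℝ 2 m, Integrable f (m.restrict A) := fun f =>
      ((Lp.memLp f).mono_measure Measure.restrict_le_self).integrable (by norm_num)
    rw [integrable_prod_iff hmeas]
    constructor
    · filter_upwards [h] with r hr
      exact (hfin (G r)).congr (ae_restrict_of_ae hr)
    · refine Integrable.mono' (hG.norm.mul_const ‖indicatorConstLp 2 hA hmA.ne (1 : ℝ)‖)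
        hmeas.norm.integral_prod_right' ?_
      filter_upwards [h] with r hr
      have e1 : ∫ s, ‖g r s‖ ∂(m.restrict A) = ∫ s in A, |G r| s ∂m := by
        refine integral_congr_ae (ae_restrict_of_ae ?_)
        filter_upwards [hr, Lp.coeFn_abs (G r)] with s h1 h2
        rw [h2, h1, Real.norm_eq_abs]
      rw [e1, ← L2.inner_indicatorConstLp_one hA hmA.ne, mul_comm]
      have e2 := norm_inner_le_norm (𝕜 := ℝ) (indicatorConstLp 2 hA hmA.ne (1 : ℝ)) |G r|
      rwa [norm_abs_eq_norm] at e2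
  refine ae_eq_of_forall_setIntegral_eq_of_sigmaFinite ?_ ?_ ?_
  · intro A hA hmA
    have : IsFiniteMeasure (m.restrict A) := ⟨by simpa using hmA⟩
    exact ((Lp.memLp _).mono_measure Measure.restrict_le_self).integrable (by norm_num)
  · intro A hA hmA
    exact (key A hA hmA).integral_prod_right
  · intro A hA hmA
    -- The integral over A is the pairing with 1_A, which commutes with the Bochner integral.
    rw [← L2.inner_indicatorConstLp_one hA hmA.ne, ← integral_inner hG,
      integral_integral_swap (f := fun s r => g r s) (key A hA hmA).swap]
    refine integral_congr_ae ?_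
    filter_upwards [h] with r hr
    rw [L2.inner_indicatorConstLp_one hA hmA.ne]
    exact integral_congr_ae (ae_restrict_of_ae hr)

/-! ### The semigroup and the control operator in `L²` form -/

lemma integral_mul_eq_inner {sbar : EReal} (x : State sbar) {φ : ℝ → ℝ}
    (hφ : MemLp φ 2 (ageMeasure sbar)) :
    ∫ s, x s * φ s ∂(ageMeasure sbar) = inner ℝ x hφ.toLp := by
  rw [L2.inner_def]
  refine integral_congr_ae ?_
  filter_upwards [hφ.coeFn_toLp] with s hs
  simp [hs, mul_comm]

lemma ae_coe_ne (sbar : EReal) : ∀ᵐ s : ℝ, (s : EReal) ≠ sbar := by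
  have : ({s : ℝ | (s : EReal) = sbar}).Subsingleton := fun a ha b hb => by
    have : (a : EReal) = b := ha.trans hb.symm
    exact_mod_cast this
  simpa [ae_iff] using this.measure_zero volume

/-- The closed condition s + t ≤ sbar and the open age interval differ only at the null age s = sbar
- t. -/
lemma adjointSemigroup_ae {sbar : EReal} (mu : ℝ) {t : ℝ} (ht : 0 ≤ t) {φ : ℝ → ℝ}
    (hφ : MemLp φ 2 (ageMeasure sbar)) :
    adjointSemigroup sbar mu t φ =ᵐ[ageMeasure sbar]
      (Real.exp (-mu * t) • ageShift sbar (-t) hφ.toLp : State sbar) := by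
  have h1 : ∀ᵐ s ∂(ageMeasure sbar), ((s + t : ℝ) : EReal) ≠ sbar :=
    ae_restrict_of_ae ((measurePreserving_add_right (volume : Measure ℝ) t).quasiMeasurePreserving.ae
      (ae_coe_ne sbar))
  have h2 : ∀ᵐ s ∂(ageMeasure sbar), s ∈ ageSet sbar :=
    ae_restrict_mem (measurableSet_ageSet sbar)
  filter_upwards [h1, h2, Lp.coeFn_smul (Real.exp (-mu * t)) (ageShift sbar (-t) hφ.toLp),
    ageShift_toLp_coeFn (-t) hφ] with s h1 h2 h3 h4
  rw [h3, Pi.smul_apply, h4, adjointSemigroup, sub_neg_eq_add]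
  by_cases h : ((s + t : ℝ) : EReal) ≤ sbar
  · have hm : s + t ∈ ageSet sbar := ⟨add_pos_of_pos_of_nonneg h2.1 ht, lt_of_le_of_ne h h1⟩
    simp only [if_pos h, indicator_of_mem hm, smul_eq_mul]
  · have hm : s + t ∉ ageSet sbar := fun hm => h hm.2.le
    rw [if_neg h, indicator_of_notMem hm, smul_zero]

/-- With the delay r as variable, the values at age 0 reproduce φ itself; hence the boundary control
is paired with φ in L² over time. -/
lemma adjointSemigroup_zero_ae (sbar : EReal) (mu : ℝ) (φ : ℝ → ℝ) :
    ∀ᵐ r : ℝ, 0 < r → adjointSemigroup sbar mu r φ 0 =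
      Real.exp (-mu * r) * (ageSet sbar).indicator φ r := by
  filter_upwards [ae_coe_ne sbar] with r hr hr0
  rw [adjointSemigroup, zero_add]
  by_cases h : (r : EReal) ≤ sbar
  · have hm : r ∈ ageSet sbar := ⟨hr0, lt_of_le_of_ne h hr⟩
    simp only [if_pos h, indicator_of_mem hm]
  · have hm : r ∉ ageSet sbar := fun hm => h hm.2.le
    rw [if_neg h, indicator_of_notMem hm, mul_zero]

/-- The pairing of a control with the adjoint semigroup, in terms of `ageShift`. -/
lemma controlOp_adjointSemigroup {sbar : EReal} (mu : ℝ) {φ : ℝ → ℝ}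
    (hφ : MemLp φ 2 (ageMeasure sbar)) :
    ∀ᵐ r : ℝ, 0 < r → ∀ u : ℝ × State sbar,
      controlOp sbar u (adjointSemigroup sbar mu r φ) =
        u.1 * (Real.exp (-mu * r) * (ageSet sbar).indicator φ r) +
          Real.exp (-mu * r) * inner ℝ u.2 (ageShift sbar (-r) hφ.toLp) := by
  filter_upwards [adjointSemigroup_zero_ae sbar mu φ] with r hr hr0 u
  rw [controlOp, hr hr0, ← real_inner_smul_right, L2.inner_def]
  congr 1
  refine integral_congr_ae ?_
  filter_upwards [adjointSemigroup_ae mu hr0.le hφ] with s hs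
  rw [hs]
  simp [mul_comm]

/-! ### Construction of mild solutions -/

/-- The initial profile on `(-T, 0)` whose translates reproduce the boundary datum `u0`. -/
def boundaryProfile (mu : ℝ) (u0 : ℝ → ℝ) (T : ℝ) : ℝ → ℝ :=
  (Ioo (-T) 0).indicator fun r => Real.exp (-mu * r) * u0 (-r)

lemma memLp_boundaryProfile (mu : ℝ) {u0 : ℝ → ℝ} {T : ℝ}
    (h : MemLp u0 2 (volume.restrict (Ioo 0 T))) : MemLp (boundaryProfile mu u0 T) 2 volume := by
  have h1 : MemLp ((Ioo 0 T).indicator fun r => Real.exp (mu * r) * u0 r) 2 volume := by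
    rw [memLp_indicator_iff_restrict measurableSet_Ioo]
    refine h.of_le_mul (c := Real.exp (|mu| * T)) ?_ ?_
    · exact (by fun_prop : Continuous fun r => Real.exp (mu * r)).aestronglyMeasurable.mul h.1
    · filter_upwards [ae_restrict_mem measurableSet_Ioo] with r hr
      rw [norm_mul]
      gcongr
      rw [Real.norm_eq_abs, Real.abs_exp]
      gcongr
      · exact hr.1.le
      · exact le_abs_self mu
      · exact hr.2.le
  have h2 := h1.comp_measurePreserving (Measure.measurePreserving_neg (volume : Measure ℝ))
  convert h2 using 1
  ext r
  have : r ∈ Ioo (-T) 0 ↔ -r ∈ Ioo 0 T := by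
    simp only [mem_Ioo]; constructor <;> rintro ⟨a, b⟩ <;> constructor <;> linarith
  by_cases hr : r ∈ Ioo (-T) 0
  · simp [boundaryProfile, hr, this.1 hr]
  · have hr' := fun h => hr (this.2 h)
    simp only [boundaryProfile, Function.comp_apply, indicator_of_notMem hr, indicator_of_notMem hr']

/-- A control which is locally square integrable on the boundary and locally integrable in the
distributed component. -/
structure LocallyAdmissible {sbar : EReal} (u : ℝ → ℝ × State sbar) : Prop where
  fst : ∀ T, MemLp (fun t => (u t).1) 2 (volume.restrict (Ioo 0 T))
  snd : ∀ T, IntegrableOn (fun t => (u t).2) (Ioc 0 T)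

/-- The integrand of the Duhamel term, transported back to time `0`. -/
def duhamelIntegrand {sbar : EReal} (mu : ℝ) (u : ℝ → ℝ × State sbar) (τ : ℝ) :
    Lp ℝ 2 (volume : Measure ℝ) :=
  Real.exp (mu * τ) • translate (-τ) (extend sbar (u τ).2)

lemma integrableOn_duhamelIntegrand {sbar : EReal} (mu : ℝ) {u : ℝ → ℝ × State sbar}
    (hu : LocallyAdmissible u) (T : ℝ) : IntegrableOn (duhamelIntegrand mu u) (Ioc 0 T) := by
  have hc : Continuous fun p : ℝ × State sbar =>
      Real.exp (mu * p.1) • translate (-p.1) (extend sbar p.2) := by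
    refine (Real.continuous_exp.comp (continuous_const.mul continuous_fst)).smul ?_
    exact continuous_translate.comp
      (continuous_fst.neg.prodMk ((extend sbar).continuous.comp continuous_snd))
  refine Integrable.mono' ((hu.snd T).norm.const_mul (Real.exp (|mu| * T))) ?_ ?_
  · have hm : AEStronglyMeasurable (fun τ : ℝ => (τ, (u τ).2)) (volume.restrict (Ioc 0 T)) :=
      aestronglyMeasurable_id.prodMk (hu.snd T).aestronglyMeasurable
    exact hc.comp_aestronglyMeasurable hm
  · filter_upwards [ae_restrict_mem measurableSet_Ioc] with r hr
    rw [duhamelIntegrand, norm_smul, norm_translate, Real.norm_eq_abs, Real.abs_exp]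
    gcongr
    · exact hr.1.le
    · exact le_abs_self mu
    · exact hr.2
    · exact norm_extend_le _

/-- The mild solution. -/
def mildSolution {sbar : EReal} (mu : ℝ) (x : State sbar) {u : ℝ → ℝ × State sbar}
    (hu : LocallyAdmissible u) (t : ℝ) : State sbar :=
  Real.exp (-mu * t) • restrictAge sbar (translate t (extend sbar x +
    (memLp_boundaryProfile mu (hu.fst t)).toLp + ∫ τ in (0 : ℝ)..t, duhamelIntegrand mu u τ))

lemma restrictAge_translate_boundaryProfile_coeFn (sbar : EReal) (mu : ℝ) {u0 : ℝ → ℝ} (t : ℝ)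
    {T : ℝ} (h : MemLp u0 2 (volume.restrict (Ioo 0 T))) :
    restrictAge sbar (translate t (memLp_boundaryProfile mu h).toLp) =ᵐ[ageMeasure sbar]
      fun s => boundaryProfile mu u0 T (s - t) := by
  have h1 := ae_restrict_of_ae (s := ageSet sbar)
    (translate_coeFn t (memLp_boundaryProfile mu h).toLp)
  have h2 := ae_restrict_of_ae (s := ageSet sbar)
    ((measurePreserving_sub_right (volume : Measure ℝ) t).quasiMeasurePreserving.ae
      (memLp_boundaryProfile mu h).coeFn_toLp)
  filter_upwards [restrictAge_coeFn sbar (translate t (memLp_boundaryProfile mu h).toLp), h1, h2]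
    with s h0 h1 h2
  rw [h0, h1, h2]

/-- Positive ages s satisfy s - t > -t, so at time t the profile beyond -t is not seen. One profile
therefore serves all t ≤ T. -/
lemma restrictAge_translate_boundaryProfile {sbar : EReal} (mu : ℝ) {u0 : ℝ → ℝ} {t T : ℝ}
    (htT : t ≤ T) (h : MemLp u0 2 (volume.restrict (Ioo 0 t)))
    (h' : MemLp u0 2 (volume.restrict (Ioo 0 T))) :
    restrictAge sbar (translate t (memLp_boundaryProfile mu h).toLp) =
      restrictAge sbar (translate t (memLp_boundaryProfile mu h').toLp) := by
  apply Lp.ext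
  have hm : ∀ᵐ s ∂(ageMeasure sbar), s ∈ ageSet sbar :=
    ae_restrict_mem (measurableSet_ageSet sbar)
  filter_upwards [restrictAge_translate_boundaryProfile_coeFn sbar mu t h,
    restrictAge_translate_boundaryProfile_coeFn sbar mu t h', hm] with s h1 h2 hs
  rw [h1, h2, boundaryProfile, boundaryProfile]
  have : s - t ∈ Ioo (-t) 0 ↔ s - t ∈ Ioo (-T) 0 := by
    have := hs.1
    simp only [mem_Ioo]; constructor <;> rintro ⟨a, b⟩ <;> constructor <;> linarith
  by_cases hst : s - t ∈ Ioo (-t) 0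
  · simp [hst, this.1 hst]
  · have hst' := fun h => hst (this.2 h)
    rw [indicator_of_notMem hst, indicator_of_notMem hst']

lemma continuousOn_mildSolution {sbar : EReal} (mu : ℝ) (x : State sbar)
    {u : ℝ → ℝ × State sbar} (hu : LocallyAdmissible u) :
    ContinuousOn (mildSolution mu x hu) (Ici 0) := by
  have key : ∀ T, 0 ≤ T → ContinuousOn (mildSolution mu x hu) (Icc 0 T) := by
    intro T hT
    have hprim : ContinuousOn (fun t => ∫ τ in (0 : ℝ)..t, duhamelIntegrand mu u τ) (Icc 0 T) := by
      have h := intervalIntegral.continuousOn_primitive_interval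
        (μ := volume) (f := duhamelIntegrand mu u) (a := 0) (b := T) (by
          rw [uIcc_of_le hT, integrableOn_Icc_iff_integrableOn_Ioc]
          exact integrableOn_duhamelIntegrand mu hu T)
      rwa [uIcc_of_le hT] at h
    -- With the horizon of the profile frozen at T, time enters only through the damping, the
    -- translation and the primitive.
    have h1 : ContinuousOn (fun t => Real.exp (-mu * t) • restrictAge sbar (translate t
        (extend sbar x + (memLp_boundaryProfile mu (hu.fst T)).toLp +
          ∫ τ in (0 : ℝ)..t, duhamelIntegrand mu u τ))) (Icc 0 T) := by
      refine (Real.continuous_exp.comp (continuous_const.mul continuous_id)).continuousOn.smul ?_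
      exact (restrictAge sbar).continuous.comp_continuousOn
        (continuous_translate.comp_continuousOn
          (continuousOn_id.prodMk (continuousOn_const.add hprim)))
    refine h1.congr fun t ht => ?_
    simp only [mildSolution, map_add]
    rw [restrictAge_translate_boundaryProfile mu ht.2 (hu.fst t) (hu.fst T)]
  intro t ht
  have ht0 : 0 ≤ t := ht
  refine ((key (t + 1) (by linarith)) t ⟨ht0, by linarith⟩).mono_of_mem_nhdsWithin ?_
  rw [← Ici_inter_Iic]
  exact inter_mem_nhdsWithin _ (Iic_mem_nhds (by linarith))

/-- The reflection τ = -r turns an integral over negative ages into one over past times. -/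
lemma inner_boundaryProfile {sbar : EReal} (mu : ℝ) {u0 : ℝ → ℝ} {t : ℝ} (ht : 0 ≤ t)
    (h : MemLp u0 2 (volume.restrict (Ioo 0 t))) {φ : ℝ → ℝ}
    (hφ : MemLp φ 2 (ageMeasure sbar)) :
    IntervalIntegrable
      (fun τ => Real.exp (mu * τ) * u0 τ * (ageSet sbar).indicator φ (t - τ)) volume 0 t ∧
    inner ℝ (memLp_boundaryProfile mu h).toLp (translate (-t) (extend sbar hφ.toLp)) =
      ∫ τ in (0 : ℝ)..t, Real.exp (mu * τ) * u0 τ * (ageSet sbar).indicator φ (t - τ) := by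
  set b := (memLp_boundaryProfile mu h).toLp
  set f := translate (-t) (extend sbar hφ.toLp)
  have hb : b =ᵐ[volume] boundaryProfile mu u0 t := (memLp_boundaryProfile mu h).coeFn_toLp
  have hext : extend sbar hφ.toLp =ᵐ[volume] (ageSet sbar).indicator φ := by
    have := (ae_restrict_iff' (measurableSet_ageSet sbar)).1 hφ.coeFn_toLp
    filter_upwards [extend_coeFn hφ.toLp, this] with s h1 h2
    rw [h1]
    by_cases hs : s ∈ ageSet sbar <;> simp [hs, h2]
  have hf : f =ᵐ[volume] fun r => (ageSet sbar).indicator φ (r + t) := by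
    have h2 := (measurePreserving_sub_right (volume : Measure ℝ) (-t)).quasiMeasurePreserving.ae hext
    filter_upwards [translate_coeFn (-t) (extend sbar hφ.toLp), h2] with r h1 h2
    rw [h1, h2, sub_neg_eq_add]
  have hbf := hb.and hf
  have hneg := (Measure.measurePreserving_neg (volume : Measure ℝ)).quasiMeasurePreserving.ae hbf
  have heq : (fun τ => (inner ℝ (b (-τ)) (f (-τ)) : ℝ)) =ᵐ[volume] (Ioo 0 t).indicator
      fun τ => Real.exp (mu * τ) * u0 τ * (ageSet sbar).indicator φ (t - τ) := by
    filter_upwards [hneg] with τ hτ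
    have hmem : -τ ∈ Ioo (-t) 0 ↔ τ ∈ Ioo 0 t := by
      simp only [mem_Ioo]; constructor <;> rintro ⟨a, b⟩ <;> constructor <;> linarith
    rw [hτ.1, hτ.2, boundaryProfile]
    by_cases h : τ ∈ Ioo 0 t
    · rw [indicator_of_mem h, indicator_of_mem (hmem.2 h), neg_add_eq_sub]
      simp [mul_comm]
    · rw [indicator_of_notMem h, indicator_of_notMem (fun h' => h (hmem.1 h'))]
      simp
  have hint : Integrable (fun τ => (inner ℝ (b (-τ)) (f (-τ)) : ℝ)) volume :=
    (L2.integrable_inner (𝕜 := ℝ) b f).comp_neg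
  constructor
  · rw [intervalIntegrable_iff_integrableOn_Ioo_of_le ht, ← integrable_indicator_iff measurableSet_Ioo]
    exact hint.congr heq
  · rw [L2.inner_def, ← integral_neg_eq_self, integral_congr_ae heq,
      integral_indicator measurableSet_Ioo, intervalIntegral.integral_of_le ht,
      integral_Ioc_eq_integral_Ioo]

lemma inner_duhamel {sbar : EReal} (mu : ℝ) {u : ℝ → ℝ × State sbar}
    (hu : LocallyAdmissible u) {t : ℝ} (ht : 0 ≤ t) (y : State sbar) :
    IntervalIntegrable (fun τ => Real.exp (mu * τ) * inner ℝ (u τ).2 (ageShift sbar (-(t - τ)) y))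
      volume 0 t ∧
    inner ℝ (∫ τ in (0 : ℝ)..t, duhamelIntegrand mu u τ) (translate (-t) (extend sbar y)) =
      ∫ τ in (0 : ℝ)..t, Real.exp (mu * τ) * inner ℝ (u τ).2 (ageShift sbar (-(t - τ)) y) := by
  have hint := integrableOn_duhamelIntegrand mu hu t
  have heq : ∀ τ, inner ℝ (translate (-t) (extend sbar y)) (duhamelIntegrand mu u τ) =
      Real.exp (mu * τ) * inner ℝ (u τ).2 (ageShift sbar (-(t - τ)) y) := by
    intro τ
    rw [duhamelIntegrand, real_inner_smul_right, real_inner_comm (translate (-τ) _),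
      inner_translate, translate_translate, real_inner_comm _ (u τ).2, ageShift_apply,
      inner_restrictAge, real_inner_comm (extend sbar (u τ).2)]
    congr 4
    ring
  constructor
  · rw [intervalIntegrable_iff_integrableOn_Ioc_of_le ht]
    exact (hint.const_inner (𝕜 := ℝ) (translate (-t) (extend sbar y))).congr
      (Eventually.of_forall heq)
  · rw [intervalIntegral.integral_of_le ht, intervalIntegral.integral_of_le ht, real_inner_comm,
      ← integral_inner hint]
    simp_rw [heq]

/-- Once restriction and translation act on φ, the three summands (initial datum, boundary profile,
Duhamel integral) match the terms of the mild equation, since e^{-μt}e^{μτ} = e^{-μ(t-τ)}. -/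
lemma isMildSolution_mildSolution {sbar : EReal} (mu : ℝ) (x : State sbar)
    {u : ℝ → ℝ × State sbar} (hu : LocallyAdmissible u) :
    IsMildSolution sbar mu x u (mildSolution mu x hu) := by
  refine ⟨continuousOn_mildSolution mu x hu, fun t ht φ hφd => ?_⟩
  obtain ⟨⟨g, hφ, -, -⟩, -⟩ := hφd
  obtain ⟨hB1, hB2⟩ := inner_boundaryProfile mu ht (hu.fst t) hφ
  obtain ⟨hD1, hD2⟩ := inner_duhamel mu hu ht hφ.toLp
  have hx : ∫ s, x s * adjointSemigroup sbar mu t φ s ∂(ageMeasure sbar) =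
      Real.exp (-mu * t) * inner ℝ x (ageShift sbar (-t) hφ.toLp) := by
    rw [← real_inner_smul_right, L2.inner_def]
    refine integral_congr_ae ?_
    filter_upwards [adjointSemigroup_ae mu ht hφ] with s hs
    rw [hs]
    simp [mul_comm]
  have hc : ∫ τ in (0 : ℝ)..t, controlOp sbar (u τ) (adjointSemigroup sbar mu (t - τ) φ) =
      Real.exp (-mu * t) *
        ((∫ τ in (0 : ℝ)..t, Real.exp (mu * τ) * (u τ).1 * (ageSet sbar).indicator φ (t - τ)) +
        ∫ τ in (0 : ℝ)..t,
          Real.exp (mu * τ) * inner ℝ (u τ).2 (ageShift sbar (-(t - τ)) hφ.toLp)) := by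
    rw [← intervalIntegral.integral_add hB1 hD1, ← intervalIntegral.integral_const_mul]
    refine intervalIntegral.integral_congr_ae ?_
    have h1 := (Measure.measurePreserving_sub_left (volume : Measure ℝ) t).quasiMeasurePreserving.ae
      (controlOp_adjointSemigroup mu hφ)
    have h2 : ∀ᵐ τ : ℝ, τ ≠ t := by simp [ae_iff, measure_singleton]
    filter_upwards [h1, h2] with τ h1 h2 hτ
    rw [uIoc_of_le ht] at hτ
    rw [h1 (sub_pos.2 (lt_of_le_of_ne hτ.2 h2)),
      show -mu * (t - τ) = -mu * t + mu * τ by ring, Real.exp_add]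
    ring
  rw [integral_mul_eq_inner _ hφ, hx, hc, mildSolution, real_inner_smul_left, inner_restrictAge,
    inner_translate, inner_add_left, inner_add_left, hB2, hD2, ← mul_add, ← add_assoc]
  rw [real_inner_comm (ageShift sbar (-t) hφ.toLp), ageShift_apply, inner_restrictAge,
    real_inner_comm (extend sbar x)]

/-! ### Uniqueness -/

lemma domAdjoint_of_contDiff {sbar : EReal} {φ : ℝ → ℝ} (h : ContDiff ℝ (⊤ : ℕ∞) φ)
    (hc : HasCompactSupport φ) (hs : tsupport φ ⊆ ageSet sbar) : DomAdjoint sbar φ := by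
  refine ⟨⟨deriv φ, ?_, ?_, fun s _ _ => ?_⟩, fun L hL => ?_⟩
  · exact h.continuous.memLp_of_hasCompactSupport hc
  · exact (h.continuous_deriv (by simp)).memLp_of_hasCompactSupport hc.deriv
  · rw [intervalIntegral.integral_deriv_eq_sub (fun x _ => (h.differentiable (by simp)) x)
      ((h.continuous_deriv (by simp)).intervalIntegrable _ _)]
    ring
  -- If φ were nonzero at L = sbar, then L would belong to the support and so to the open age
  -- interval.
  · by_contra hne
    exact (hs (subset_tsupport φ hne)).2.ne hL

/-- Smooth functions with compact support in (0, sbar) belong to D(A*), so the fundamental lemma of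
the calculus of variations applies. -/
lemma eq_of_forall_domAdjoint {sbar : EReal} {y z : State sbar}
    (h : ∀ φ, DomAdjoint sbar φ →
      ∫ s, y s * φ s ∂(ageMeasure sbar) = ∫ s, z s * φ s ∂(ageMeasure sbar)) : y = z := by
  have hloc : LocallyIntegrableOn (fun s => y s - z s) (ageSet sbar) volume :=
    locallyIntegrableOn_of_locallyIntegrable_restrict
      (((Lp.memLp y).sub (Lp.memLp z)).locallyIntegrable (by norm_num))
  have := (isOpen_ageSet sbar).ae_eq_zero_of_integral_contDiff_smul_eq_zero hloc
    fun φ hφ hc hs => by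
      have hd := domAdjoint_of_contDiff hφ hc hs
      obtain ⟨⟨g, hm, -, -⟩, -⟩ := id hd
      have hi : ∀ w : State sbar, Integrable (fun s => w s * φ s) (ageMeasure sbar) := fun w =>
        (Lp.memLp w).integrable_mul hm
      have h0 : φ.support ⊆ ageSet sbar := (subset_tsupport φ).trans hs
      have hsupp : (fun s => φ s • (y s - z s)).support ⊆ ageSet sbar :=
        (Function.support_smul_subset_left _ _).trans h0
      rw [← setIntegral_eq_integral_of_forall_compl_eq_zero
        (fun s hs' => Function.notMem_support.1 fun h' => hs' (hsupp h')), ← ageMeasure_eq]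
      have e := sub_eq_zero.2 (h φ hd)
      rw [← integral_sub (hi y) (hi z)] at e
      rw [← e]
      refine integral_congr_ae (Eventually.of_forall fun s => ?_)
      simp only [smul_eq_mul]
      ring
  apply Lp.ext
  filter_upwards [(ae_restrict_iff' (measurableSet_ageSet sbar)).2 this] with s hs
  exact sub_eq_zero.1 hs

lemma IsMildSolution.eqOn {sbar : EReal} {mu : ℝ} {x : State sbar} {u : ℝ → ℝ × State sbar}
    {y y' : ℝ → State sbar} (h : IsMildSolution sbar mu x u y)
    (h' : IsMildSolution sbar mu x u y') : EqOn y' y (Ici 0) := fun t ht =>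
  eq_of_forall_domAdjoint fun φ hφ => (h'.2 t ht φ hφ).trans (h.2 t ht φ hφ).symm

/-! ### Admissible controls -/

/-- From a ≤ 1 + a²: the weight e^{-ρt} is itself integrable because ρ > 0. -/
lemma Admissible.integrableOn_discounted {sbar : EReal} {ρ : ℝ} (hρ : 0 < ρ)
    {u : ℝ → ℝ × State sbar} (hu : Admissible sbar ρ u) :
    IntegrableOn (fun t => Real.exp (-ρ * t) • u t) (Ioi 0) := by
  refine Integrable.mono' ((exp_neg_integrableOn_Ioi 0 hρ).add hu.2) ?_ ?_
  · exact (by fun_prop : Continuous fun t : ℝ => Real.exp (-ρ * t)).aestronglyMeasurable.smul hu.1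
  · refine Eventually.of_forall fun t => ?_
    have h1 : ‖u t‖ ≤ |(u t).1| + ‖(u t).2‖ := by
      rw [Prod.norm_def, Real.norm_eq_abs]
      exact max_le_add_of_nonneg (abs_nonneg _) (norm_nonneg _)
    rw [norm_smul, Real.norm_eq_abs, Real.abs_exp, Pi.add_apply]
    have : ‖u t‖ ≤ 1 + (|(u t).1| + ‖(u t).2‖) ^ 2 := by
      nlinarith [sq_nonneg (|(u t).1| + ‖(u t).2‖ - 1)]
    nlinarith [mul_le_mul_of_nonneg_left this (Real.exp_pos (-ρ * t)).le]

lemma Admissible.locallyAdmissible {sbar : EReal} {ρ : ℝ} (hρ : 0 < ρ)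
    {u : ℝ → ℝ × State sbar} (hu : Admissible sbar ρ u) : LocallyAdmissible u where
  fst T := by
    have hsub : Ioo 0 T ⊆ Ioi (0 : ℝ) := fun t ht => ht.1
    have hm : AEStronglyMeasurable (fun t => (u t).1) (volume.restrict (Ioo 0 T)) :=
      (hu.1.mono_measure (Measure.restrict_mono_set _ hsub)).fst
    rw [memLp_two_iff_integrable_sq hm]
    refine Integrable.mono' ((hu.2.mono_set hsub).const_mul (Real.exp (ρ * T))) (hm.pow 2) ?_
    filter_upwards [ae_restrict_mem measurableSet_Ioo] with t ht
    rw [← mul_assoc, ← Real.exp_add, Real.norm_eq_abs, abs_pow]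
    -- On (0, T) the weight is at least e^{-ρT}, so discounted bounds give local ones.
    have h1 : 1 ≤ Real.exp (ρ * T + -ρ * t) := Real.one_le_exp (by nlinarith [ht.2])
    have h2 : |(u t).1| ^ 2 ≤ (|(u t).1| + ‖(u t).2‖) ^ 2 := by
      gcongr
      exact le_add_of_nonneg_right (norm_nonneg _)
    nlinarith [sq_nonneg (|(u t).1| + ‖(u t).2‖)]
  snd T := by
    have hsub : Ioc 0 T ⊆ Ioi (0 : ℝ) := fun t ht => ht.1
    have hd := ((hu.integrableOn_discounted hρ).mono_set hsub).norm
    refine Integrable.mono' (hd.const_mul (Real.exp (ρ * T)))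
      (hu.1.mono_measure (Measure.restrict_mono_set _ hsub)).snd ?_
    filter_upwards [ae_restrict_mem measurableSet_Ioc] with t ht
    rw [norm_smul, ← mul_assoc, Real.norm_eq_abs, Real.abs_exp, ← Real.exp_add]
    have h1 : 1 ≤ Real.exp (ρ * T + -ρ * t) := Real.one_le_exp (by nlinarith [ht.2])
    nlinarith [norm_snd_le (u t), norm_nonneg (u t)]

/-! ### The discounted revenue -/

lemma integrable_exp_ageMeasure {sbar : EReal} {r : ℝ} (h : sbar = ⊤ → 0 < r) :
    Integrable (fun s : ℝ => Real.exp (-r * s)) (ageMeasure sbar) := by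
  rw [ageMeasure_eq]
  induction sbar with
  | bot => simp [ageSet]
  | top =>
    refine (exp_neg_integrableOn_Ioi 0 (h rfl)).mono_set fun s hs => hs.1
  | coe L =>
    have : ageSet L ⊆ Icc 0 L := fun s hs => ⟨hs.1.le, (EReal.coe_lt_coe_iff.1 hs.2).le⟩
    exact ((by fun_prop : Continuous fun s : ℝ => Real.exp (-r * s)).integrableOn_Icc).mono_set this

lemma memLp_exp_ageMeasure {sbar : EReal} {r : ℝ} (h : sbar = ⊤ → 0 < r) :
    MemLp (fun s : ℝ => Real.exp (-r * s)) 2 (ageMeasure sbar) := by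
  rw [memLp_two_iff_integrable_sq
    (by fun_prop : Continuous fun s : ℝ => Real.exp (-r * s)).aestronglyMeasurable]
  refine (integrable_exp_ageMeasure (r := 2 * r) fun h' => by linarith [h h']).congr ?_
  refine Eventually.of_forall fun s => ?_
  simp only [pow_two, ← Real.exp_add]
  congr 1
  ring

/-- All capital is gone after a delay of at least sbar. The kernel can thus be cut off outside the
age interval, and for finite sbar its integrability requires no sign of ρ + μ. -/
lemma ageShift_neg_eq_zero {sbar : EReal} {r : ℝ} (hr : 0 < r) (h : r ∉ ageSet sbar)
    (x : State sbar) : ageShift sbar (-r) x = 0 := by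
  apply Lp.ext
  have hm : ∀ᵐ s ∂(ageMeasure sbar), s ∈ ageSet sbar :=
    ae_restrict_mem (measurableSet_ageSet sbar)
  filter_upwards [ageShift_coeFn (-r) x, hm, Lp.coeFn_zero ℝ 2 (ageMeasure sbar)] with s h1 h2 h3
  have : s - -r ∉ ageSet sbar := fun h' =>
    h ⟨hr, (EReal.coe_le_coe (by linarith [h2.1])).trans_lt h'.2⟩
  rw [h1, h3, indicator_of_notMem this, Pi.zero_apply]

/-- The discounted adjoint semigroup `e^{-lr} φ(· + r)`, with the value at `0` as first component;
it vanishes for `r` outside of the age interval. -/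
def revenueKernel {sbar : EReal} (l : ℝ) {φ : ℝ → ℝ} (hφ : MemLp φ 2 (ageMeasure sbar)) :
    ℝ → ℝ × State sbar :=
  (ageSet sbar).indicator fun r =>
    (Real.exp (-l * r) * φ r, Real.exp (-l * r) • ageShift sbar (-r) hφ.toLp)

lemma integrable_revenueKernel {sbar : EReal} {l : ℝ} (hl : sbar = ⊤ → 0 < l) {φ : ℝ → ℝ}
    (hφ : MemLp φ 2 (ageMeasure sbar)) : Integrable (revenueKernel l hφ) := by
  refine (integrable_indicator_iff (measurableSet_ageSet sbar)).2 (Integrable.prodMk ?_ ?_)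
  · exact (memLp_exp_ageMeasure hl).integrable_mul hφ
  · refine Integrable.mono' ((integrable_exp_ageMeasure hl).mul_const ‖hφ.toLp‖) ?_ ?_
    · have hc : Continuous fun r : ℝ => ageShift sbar (-r) hφ.toLp :=
        (continuous_ageShift sbar).comp (continuous_neg.prodMk continuous_const)
      exact ((Real.continuous_exp.comp (continuous_const.mul continuous_id)).smul
        hc).aestronglyMeasurable
    · refine Eventually.of_forall fun r => ?_
      rw [norm_smul, Real.norm_eq_abs, Real.abs_exp]
      gcongr
      exact norm_ageShift_le _ _

/-- The duality pairing of `ℝ × L²` with itself. -/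
def pairing (sbar : EReal) : (ℝ × State sbar) →L[ℝ] (ℝ × State sbar) →L[ℝ] ℝ :=
  (ContinuousLinearMap.mul ℝ ℝ).bilinearComp (ContinuousLinearMap.fst ℝ ℝ (State sbar))
      (ContinuousLinearMap.fst ℝ ℝ (State sbar)) +
    (isBoundedBilinearMap_inner (𝕜 := ℝ) (E := State sbar)).toContinuousLinearMap.bilinearComp
      (ContinuousLinearMap.snd ℝ ℝ (State sbar)) (ContinuousLinearMap.snd ℝ ℝ (State sbar))

lemma pairing_apply {sbar : EReal} (u k : ℝ × State sbar) :
    pairing sbar u k = u.1 * k.1 + inner ℝ u.2 k.2 := rfl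

/-- The discounted control, extended by zero to negative times. -/
def discountedControl {sbar : EReal} (ρ : ℝ) (u : ℝ → ℝ × State sbar) : ℝ → ℝ × State sbar :=
  (Ioi (0 : ℝ)).indicator fun t => Real.exp (-ρ * t) • u t

open scoped Convolution in
lemma discounted_revenue_eq {sbar : EReal} {mu ρ : ℝ} {x : State sbar} {u : ℝ → ℝ × State sbar}
    {y : ℝ → State sbar} (hy : IsMildSolution sbar mu x u y) {φ : ℝ → ℝ}
    (hφ : MemLp φ 2 (ageMeasure sbar)) (hd : DomAdjoint sbar φ) {t : ℝ} (ht : 0 < t) :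
    Real.exp (-ρ * t) * inner ℝ (y t) hφ.toLp =
      inner ℝ x (revenueKernel (ρ + mu) hφ t).2 +
        (discountedControl ρ u ⋆[pairing sbar, volume] revenueKernel (ρ + mu) hφ) t := by
  have hK : ∀ r, 0 < r → (revenueKernel (ρ + mu) hφ r).2 =
      (Real.exp (-ρ * r) * Real.exp (-mu * r)) • ageShift sbar (-r) hφ.toLp := by
    intro r hr
    rw [← Real.exp_add, show -ρ * r + -mu * r = -(ρ + mu) * r by ring]
    by_cases h : r ∈ ageSet sbar
    · rw [revenueKernel, indicator_of_mem h]
    · rw [revenueKernel, indicator_of_notMem h, ageShift_neg_eq_zero hr h, smul_zero, Prod.snd_zero]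
  have hK1 : ∀ r, (revenueKernel (ρ + mu) hφ r).1 =
      Real.exp (-ρ * r) * (Real.exp (-mu * r) * (ageSet sbar).indicator φ r) := by
    intro r
    rw [← mul_assoc, ← Real.exp_add, show -ρ * r + -mu * r = -(ρ + mu) * r by ring]
    by_cases h : r ∈ ageSet sbar
    · rw [revenueKernel, indicator_of_mem h, indicator_of_mem h]
    · rw [revenueKernel, indicator_of_notMem h, indicator_of_notMem h, mul_zero, Prod.fst_zero]
  have hx : ∫ s, x s * adjointSemigroup sbar mu t φ s ∂(ageMeasure sbar) =
      Real.exp (-mu * t) * inner ℝ x (ageShift sbar (-t) hφ.toLp) := by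
    rw [← real_inner_smul_right, L2.inner_def]
    refine integral_congr_ae ?_
    filter_upwards [adjointSemigroup_ae mu ht.le hφ] with s hs
    rw [hs]
    simp [mul_comm]
  rw [← integral_mul_eq_inner, hy.2 t ht.le φ hd, hx, hK t ht, real_inner_smul_right, mul_add,
    ← mul_assoc, convolution_def]
  congr 1
  rw [← intervalIntegral.integral_const_mul, intervalIntegral.integral_of_le ht.le,
    ← integral_indicator measurableSet_Ioc]
  refine integral_congr_ae ?_
  have h1 := (Measure.measurePreserving_sub_left (volume : Measure ℝ) t).quasiMeasurePreserving.ae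
    (controlOp_adjointSemigroup mu hφ)
  have h2 : ∀ᵐ τ : ℝ, τ ≠ t := by simp [ae_iff, measure_singleton]
  filter_upwards [h1, h2] with τ h1 h2
  by_cases h0 : 0 < τ
  · by_cases hτ : τ ≤ t
    · have hr : 0 < t - τ := sub_pos.2 (lt_of_le_of_ne hτ h2)
      rw [indicator_of_mem (show τ ∈ Ioc 0 t from ⟨h0, hτ⟩), h1 hr, discountedControl,
        indicator_of_mem (show τ ∈ Ioi 0 from h0), pairing_apply, hK1, hK _ hr,
        show -ρ * t = -ρ * τ + -ρ * (t - τ) by ring, Real.exp_add]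
      simp only [Prod.smul_fst, Prod.smul_snd, smul_eq_mul, real_inner_smul_left,
        real_inner_smul_right]
      ring
    -- Causality: the kernel vanishes at negative delays, so the convolution over ℝ stops at τ = t.
    · have hn : t - τ ∉ ageSet sbar := fun h => by have := h.1; linarith
      rw [indicator_of_notMem (fun h : τ ∈ Ioc 0 t => hτ h.2), revenueKernel,
        indicator_of_notMem hn, map_zero]
  · rw [indicator_of_notMem (fun h : τ ∈ Ioc 0 t => h0 h.1), discountedControl,
      indicator_of_notMem (fun h : τ ∈ Ioi 0 => h0 h)]
    simp

-- Young's inequality L¹ ⋆ L¹ ⊂ L¹ gives convergence, and the integral of a convolution is the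
-- pairing of the two integrals.
open scoped Convolution in
lemma integral_discounted_revenue {sbar : EReal} {mu ρ : ℝ} (hρ : 0 < ρ)
    (hmu : sbar = ⊤ → 0 < ρ + mu) {x : State sbar} {u : ℝ → ℝ × State sbar}
    (hu : Admissible sbar ρ u)
    {y : ℝ → State sbar} (hy : IsMildSolution sbar mu x u y) {φ : ℝ → ℝ}
    (hφ : MemLp φ 2 (ageMeasure sbar)) (hd : DomAdjoint sbar φ) :
    IntegrableOn (fun t => Real.exp (-ρ * t) * inner ℝ (y t) hφ.toLp) (Ioi 0) ∧
    ∫ t in Ioi 0, Real.exp (-ρ * t) * inner ℝ (y t) hφ.toLp =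
      inner ℝ x (∫ r, revenueKernel (ρ + mu) hφ r).2 +
        ∫ t in Ioi 0, Real.exp (-ρ * t) *
          pairing sbar (u t) (∫ r, revenueKernel (ρ + mu) hφ r) := by
  set K := revenueKernel (ρ + mu) hφ with hKdef
  have hK : Integrable K := integrable_revenueKernel hmu hφ
  have hf : Integrable (discountedControl ρ u) :=
    (integrable_indicator_iff measurableSet_Ioi).2 (hu.integrableOn_discounted hρ)
  have hK2 : Integrable fun t => (K t).2 := hK.snd
  have hKx : Integrable fun t => (inner ℝ x (K t).2 : ℝ) := hK2.const_inner x
  have hconv := hf.integrable_convolution (pairing sbar) hK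
  have hneg : ∀ t, t ∉ Ioi (0 : ℝ) → K t = 0 := fun t ht =>
    indicator_of_notMem (fun h => ht h.1) _
  have hzero : ∀ t, t ∉ Ioi (0 : ℝ) → inner ℝ x (K t).2 +
      (discountedControl ρ u ⋆[pairing sbar, volume] K) t = 0 := by
    intro t ht
    rw [hneg t ht, Prod.snd_zero, inner_zero_right, zero_add, convolution_def]
    refine integral_eq_zero_of_ae (Eventually.of_forall fun τ => ?_)
    by_cases h0 : 0 < τ
    · have : t - τ ∉ Ioi (0 : ℝ) := by
        simp only [mem_Ioi, not_lt] at ht ⊢; linarith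
      simp [hneg _ this]
    · simp [discountedControl, h0]
  have heq : EqOn (fun t => Real.exp (-ρ * t) * inner ℝ (y t) hφ.toLp)
      (fun t => inner ℝ x (K t).2 + (discountedControl ρ u ⋆[pairing sbar, volume] K) t)
      (Ioi 0) := fun t ht => discounted_revenue_eq hy hφ hd ht
  constructor
  · exact (hKx.add hconv).integrableOn.congr_fun heq.symm measurableSet_Ioi
  · rw [setIntegral_congr_fun measurableSet_Ioi heq,
      setIntegral_eq_integral_of_forall_compl_eq_zero hzero, integral_add hKx hconv,
      integral_inner hK2, integral_convolution (pairing sbar) hf hK, snd_integral hK]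
    congr 1
    have h1 := ((pairing sbar).flip (∫ r, K r)).integral_comp_comm hf
    simp only [ContinuousLinearMap.flip_apply] at h1
    rw [← h1, ← integral_indicator measurableSet_Ioi]
    refine integral_congr_ae (Eventually.of_forall fun t => ?_)
    by_cases h0 : t ∈ Ioi (0 : ℝ)
    · simp only [discountedControl, indicator_of_mem h0, map_smul, smul_apply,
        smul_eq_mul]
    · simp only [discountedControl, indicator_of_notMem h0, map_zero, zero_apply]

lemma aestronglyMeasurable_indicator_comp {sbar : EReal} {φ : ℝ → ℝ}
    (hφ : AEStronglyMeasurable φ (ageMeasure sbar)) {q : ℝ × ℝ → ℝ}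
    (hq : Measure.QuasiMeasurePreserving q (volume.prod volume) volume) (S T : Set ℝ) :
    AEStronglyMeasurable (fun p => (ageSet sbar).indicator φ (q p))
      ((volume.restrict S).prod (volume.restrict T)) := by
  have h := (aestronglyMeasurable_indicator_iff (measurableSet_ageSet sbar)).2 hφ
  exact (h.comp_quasiMeasurePreserving hq).mono_measure
    (Measure.prod_mono Measure.restrict_le_self Measure.restrict_le_self)

lemma fst_integral_revenueKernel {sbar : EReal} {mu : ℝ} {c : Coeffs}
    (hmu : sbar = ⊤ → 0 < c.ρ + mu) (hα : MemLp c.α 2 (ageMeasure sbar)) :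
    (∫ r, revenueKernel (c.ρ + mu) hα r).1 = alphaBar sbar mu c 0 := by
  rw [fst_integral (integrable_revenueKernel hmu hα), alphaBar]
  change _ = ∫ σ in ageSet sbar, _
  rw [← integral_indicator (measurableSet_ageSet sbar)]
  refine integral_congr_ae (Eventually.of_forall fun r => ?_)
  by_cases h : r ∈ ageSet sbar <;> simp [revenueKernel, h]

/-- Evaluated at age s, the integral is that of e^{-(ρ+μ)r} α(r + s) over r, which is ᾱ(s) after σ =
r + s. -/
lemma snd_integral_revenueKernel {sbar : EReal} {mu : ℝ} {c : Coeffs}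
    (hmu : sbar = ⊤ → 0 < c.ρ + mu) (hα : MemLp c.α 2 (ageMeasure sbar)) :
    (∫ r, revenueKernel (c.ρ + mu) hα r).2 =ᵐ[ageMeasure sbar] alphaBar sbar mu c := by
  have hK := integrable_revenueKernel hmu hα
  have hK2 : IntegrableOn (fun r => Real.exp (-(c.ρ + mu) * r) • ageShift sbar (-r) hα.toLp)
      (ageSet sbar) :=
    ((integrable_indicator_iff (measurableSet_ageSet sbar)).1 hK).snd
  have e1 : (∫ r, revenueKernel (c.ρ + mu) hα r).2 =
      ∫ r, Real.exp (-(c.ρ + mu) * r) • ageShift sbar (-r) hα.toLp ∂(ageMeasure sbar) := by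
    rw [snd_integral hK]
    change _ = ∫ r in ageSet sbar, _
    rw [← integral_indicator (measurableSet_ageSet sbar)]
    refine integral_congr_ae (Eventually.of_forall fun r => ?_)
    by_cases h : r ∈ ageSet sbar <;> simp [revenueKernel, h]
  rw [e1]
  have e2 := coeFn_integral_Lp (m := ageMeasure sbar) (ν := ageMeasure sbar) hK2
    (g := fun r s => Real.exp (-(c.ρ + mu) * r) * (ageSet sbar).indicator c.α (r + s))
    ((by fun_prop : Continuous fun p : ℝ × ℝ =>
      Real.exp (-(c.ρ + mu) * p.1)).aestronglyMeasurable.mul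
      (aestronglyMeasurable_indicator_comp hα.1 (quasiMeasurePreserving_add volume volume) _ _))
    (Eventually.of_forall fun r => by
      filter_upwards [Lp.coeFn_smul (Real.exp (-(c.ρ + mu) * r)) (ageShift sbar (-r) hα.toLp),
        ageShift_toLp_coeFn (-r) hα] with s h1 h2
      rw [h1, Pi.smul_apply, h2, sub_neg_eq_add, smul_eq_mul, add_comm s])
  have hm : ∀ᵐ s ∂(ageMeasure sbar), s ∈ ageSet sbar :=
    ae_restrict_mem (measurableSet_ageSet sbar)
  filter_upwards [e2, hm] with s hs hsm
  have hS : MeasurableSet {σ : ℝ | s < σ ∧ (σ : EReal) < sbar} :=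
    (isOpen_Ioi.inter (isOpen_Iio.preimage continuous_coe_real_ereal)).measurableSet
  rw [hs, alphaBar, ← integral_indicator hS]
  refine Eq.trans ?_ (integral_add_right_eq_self _ s)
  refine (integral_indicator (measurableSet_ageSet sbar)).symm.trans ?_
  refine integral_congr_ae (Eventually.of_forall fun r => ?_)
  -- The cut-off r < sbar in the kernel costs nothing: r < r + s < sbar.
  have hiff : r + s ∈ {σ : ℝ | s < σ ∧ (σ : EReal) < sbar} ↔
      r ∈ ageSet sbar ∧ r + s ∈ ageSet sbar := by
    have := hsm.1
    constructor
    · rintro ⟨h1, h2⟩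
      have hr : 0 < r := by linarith
      exact ⟨⟨hr, (EReal.coe_le_coe (by linarith)).trans_lt h2⟩, by linarith, h2⟩
    · rintro ⟨h1, h2⟩
      exact ⟨by linarith [h1.1], h2.2⟩
  by_cases h : r + s ∈ {σ : ℝ | s < σ ∧ (σ : EReal) < sbar}
  · have h' := hiff.1 h
    simp only [indicator_of_mem h, indicator_of_mem h'.1, indicator_of_mem h'.2,
      add_sub_cancel_right]
  · simp only [indicator_of_notMem h]
    by_cases h1 : r ∈ ageSet sbar
    · have h2 : r + s ∉ ageSet sbar := fun h2 => h (hiff.2 ⟨h1, h2⟩)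
      simp only [indicator_of_mem h1, indicator_of_notMem h2, mul_zero]
    · rw [indicator_of_notMem h1]

/-! ### Multiplication operators and the coefficient `β1` -/

lemma memLp_mul_of_ae_le {sbar : EReal} {b : ℝ → ℝ} {C : ℝ}
    (hb : AEStronglyMeasurable b (ageMeasure sbar))
    (hC : ∀ᵐ s ∂(ageMeasure sbar), |b s| ≤ C) (w : State sbar) :
    MemLp (fun s => b s * w s) 2 (ageMeasure sbar) := by
  refine (Lp.memLp w).of_le_mul (c := C) (hb.mul (Lp.aestronglyMeasurable w)) ?_
  filter_upwards [hC] with s hs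
  rw [norm_mul, Real.norm_eq_abs]
  gcongr

/-- Multiplication by a bounded function. -/
def mulOp {sbar : EReal} {b : ℝ → ℝ} {C : ℝ} (hb : AEStronglyMeasurable b (ageMeasure sbar))
    (hC : ∀ᵐ s ∂(ageMeasure sbar), |b s| ≤ C) : State sbar →L[ℝ] State sbar :=
  LinearMap.mkContinuous
    { toFun := fun w => (memLp_mul_of_ae_le hb hC w).toLp
      map_add' := fun w v => by
        rw [← MemLp.toLp_add]
        refine MemLp.toLp_congr _ _ ?_
        filter_upwards [Lp.coeFn_add w v] with s hs
        rw [hs, Pi.add_apply, Pi.add_apply, mul_add]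
      map_smul' := fun a w => by
        rw [RingHom.id_apply, ← MemLp.toLp_const_smul]
        refine MemLp.toLp_congr _ _ ?_
        filter_upwards [Lp.coeFn_smul a w] with s hs
        rw [hs, Pi.smul_apply, Pi.smul_apply, smul_eq_mul, smul_eq_mul]
        ring }
    C fun w => by
      refine Lp.norm_le_mul_norm_of_ae_le_mul ?_
      filter_upwards [hC, (memLp_mul_of_ae_le hb hC w).coeFn_toLp] with s h1 h2
      rw [LinearMap.coe_mk, AddHom.coe_mk, h2, norm_mul, Real.norm_eq_abs]
      gcongr

lemma mulOp_coeFn {sbar : EReal} {b : ℝ → ℝ} {C : ℝ}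
    (hb : AEStronglyMeasurable b (ageMeasure sbar))
    (hC : ∀ᵐ s ∂(ageMeasure sbar), |b s| ≤ C) (w : State sbar) :
    mulOp hb hC w =ᵐ[ageMeasure sbar] fun s => b s * w s :=
  (memLp_mul_of_ae_le hb hC w).coeFn_toLp

lemma ageSet_coe (L : ℝ) : ageSet (L : EReal) = Ioo 0 L := by
  ext s; simp [ageSet]

lemma antitoneOn_of_hasH1Deriv {sbar : EReal} {f g : ℝ → ℝ}
    (h : ∀ L : ℝ, 0 < L → (L : EReal) ≤ sbar → HasH1Deriv (L : EReal) f g)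
    (hg : ∀ᵐ s ∂(ageMeasure sbar), g s ≤ 0) {s t : ℝ} (hs : 0 ≤ s) (hst : s ≤ t)
    (ht : (t : EReal) ≤ sbar) : f t ≤ f s := by
  rcases hst.eq_or_lt with rfl | hst
  · exact le_rfl
  have ht0 : 0 < t := hs.trans_lt hst
  obtain ⟨-, hg2, hfg⟩ := h t ht0 ht
  have hgint : IntervalIntegrable g volume 0 t := by
    rw [intervalIntegrable_iff_integrableOn_Ioo_of_le ht0.le]
    rw [ageMeasure_eq, ageSet_coe] at hg2
    exact hg2.integrable (by norm_num)
  have h1 : IntervalIntegrable g volume 0 s := hgint.mono_set (by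
    rw [uIcc_of_le hs, uIcc_of_le ht0.le]; exact Icc_subset_Icc_right hst.le)
  have e := intervalIntegral.integral_interval_sub_left hgint h1
  have hneg : ∫ σ in s..t, g σ ≤ 0 := by
    rw [intervalIntegral.integral_of_le hst.le, integral_Ioc_eq_integral_Ioo]
    refine integral_nonpos_of_ae ?_
    refine ae_restrict_of_ae_restrict_of_subset (fun σ hσ => ?_) hg
    exact ⟨hs.trans_lt hσ.1, (EReal.coe_lt_coe_iff.2 hσ.2).trans_le ht⟩
  have es := hfg s hs (EReal.coe_le_coe hst.le)
  have et := hfg t ht0.le le_rfl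
  linarith

/-! ### The data of the problem in `L²` form -/

/-- The consequences of the assumptions on the coefficients that enter the solution of the control
problem; `M` is the multiplication by `β1`. -/
structure ProblemData (sbar : EReal) (mu : ℝ) (c : Coeffs) where
  rho_pos : 0 < c.ρ
  rate_pos : sbar = ⊤ → 0 < c.ρ + mu
  memLp_alpha : MemLp c.α 2 (ageMeasure sbar)
  domAdjoint_alpha : DomAdjoint sbar c.α
  memLp_q1 : MemLp c.q1 2 (ageMeasure sbar)
  meas_beta1 : AEStronglyMeasurable c.β1 (ageMeasure sbar)
  ε : ℝ
  ε_pos : 0 < ε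
  le_beta1 : ∀ᵐ s ∂(ageMeasure sbar), ε ≤ c.β1 s
  le_beta0 : ε ≤ c.β0
  M : State sbar →L[ℝ] State sbar
  M_coeFn : ∀ w, M w =ᵐ[ageMeasure sbar] fun s => c.β1 s * w s

lemma CoeffAssumption.nonempty_problemData {sbar : EReal} (hsbar : 0 < sbar) {mu : ℝ} {c : Coeffs}
    (hρ : 0 < c.ρ) (hc : CoeffAssumption sbar c) (hmu : sbar = ⊤ → -mu < c.ρ) :
    Nonempty (ProblemData sbar mu c) := by
  obtain ⟨g, hα, -⟩ := hc.alpha_mem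
  obtain ⟨_, hq, -⟩ := hc.q1_mem
  obtain ⟨g, hβ, hg⟩ := hc.beta1_mem
  obtain ⟨ε, hε, hle⟩ := hc.beta1_bound
  -- Monotonicity of β₁ supplies both its measurability and its bound β₁(0), so that multiplication
  -- by β₁ is a bounded operator even when sbar = ∞.
  have hanti : AntitoneOn c.β1 (ageSet sbar) := fun s hs t ht hst =>
    antitoneOn_of_hasH1Deriv hβ hg hs.1.le hst ht.2.le
  have hm : ∀ᵐ s ∂(ageMeasure sbar), s ∈ ageSet sbar :=
    ae_restrict_mem (measurableSet_ageSet sbar)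
  have hmeas : AEStronglyMeasurable c.β1 (ageMeasure sbar) :=
    (aemeasurable_restrict_of_antitoneOn (measurableSet_ageSet sbar) hanti).aestronglyMeasurable
  have hbd : ∀ᵐ s ∂(ageMeasure sbar), |c.β1 s| ≤ c.β1 0 := by
    filter_upwards [hm] with s hs
    rw [abs_of_nonneg (hε.le.trans (hle s hs.1.le hs.2.le))]
    exact antitoneOn_of_hasH1Deriv hβ hg le_rfl hs.1.le hs.2.le
  exact ⟨{
    rho_pos := hρ
    rate_pos := fun h => by linarith [hmu h]
    memLp_alpha := hα.1
    domAdjoint_alpha := ⟨⟨_, hα⟩, hc.alpha_end⟩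
    memLp_q1 := hq.1
    meas_beta1 := hmeas
    ε := ε
    ε_pos := hε
    le_beta1 := by filter_upwards [hm] with s hs using hle s hs.1.le hs.2.le
    -- ε ≤ β₁(0) ≤ β₀.
    le_beta0 := (hle 0 le_rfl (by exact_mod_cast hsbar.le)).trans hc.beta0_ge
    M := mulOp hmeas hbd
    M_coeFn := mulOp_coeFn hmeas hbd }⟩

/-! ### The quadratic cost, its maximiser and the loss -/

namespace ProblemData

variable {sbar : EReal} {mu : ℝ} {c : Coeffs} (D : ProblemData sbar mu c)

include D

lemma inner_M (w v : State sbar) :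
    inner ℝ (D.M w) v = ∫ s, c.β1 s * w s * v s ∂(ageMeasure sbar) := by
  rw [L2.inner_def]
  refine integral_congr_ae ?_
  filter_upwards [D.M_coeFn w] with s hs
  simp [hs, mul_comm]

lemma inner_M_comm (w v : State sbar) : inner ℝ (D.M w) v = inner ℝ (D.M v) w := by
  rw [D.inner_M, D.inner_M]
  congr 1
  ext s
  ring

lemma integrable_beta1_sq (w : State sbar) :
    Integrable (fun s => c.β1 s * w s ^ 2) (ageMeasure sbar) := by
  refine ((Lp.memLp (D.M w)).integrable_mul (Lp.memLp w)).congr ?_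
  filter_upwards [D.M_coeFn w] with s hs
  rw [Pi.mul_apply, hs]
  ring

/-- Coercivity of the cost, the source of uniqueness of the optimal control. -/
lemma le_inner_M (w : State sbar) : D.ε * ‖w‖ ^ 2 ≤ inner ℝ (D.M w) w := by
  rw [← real_inner_self_eq_norm_sq, L2.inner_def, ← integral_const_mul, D.inner_M]
  refine integral_mono_ae ((L2.integrable_inner (𝕜 := ℝ) w w).const_mul _) ?_ ?_
  · refine (D.integrable_beta1_sq w).congr (Eventually.of_forall fun s => ?_)
    simp only
    ring
  · filter_upwards [D.le_beta1] with s hs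
    simp only [RCLike.inner_apply, conj_trivial]
    nlinarith [mul_self_nonneg (w s)]

/-- The function `ᾱ` as an element of `L²`. -/
def alphaBarLp : State sbar := (∫ r, revenueKernel (c.ρ + mu) D.memLp_alpha r).2

lemma alphaBarLp_coeFn : D.alphaBarLp =ᵐ[ageMeasure sbar] alphaBar sbar mu c :=
  snd_integral_revenueKernel D.rate_pos D.memLp_alpha

lemma memLp_optDistributed : MemLp (optDistributed sbar mu c) 2 (ageMeasure sbar) := by
  have h := (((memLp_congr_ae D.alphaBarLp_coeFn).1 (Lp.memLp D.alphaBarLp)).sub D.memLp_q1)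
  -- The factor 1/(2β₁) is at most 1/(2ε).
  refine h.of_le_mul (c := (2 * D.ε)⁻¹) ?_ ?_
  · exact (h.1.aemeasurable.div (D.meas_beta1.aemeasurable.const_mul 2)).aestronglyMeasurable
  · filter_upwards [D.le_beta1] with s hs
    have := D.ε_pos
    rw [optDistributed, norm_div, div_eq_inv_mul, Pi.sub_apply]
    gcongr
    rw [Real.norm_eq_abs, abs_of_pos (by linarith)]
    linarith

/-- The optimal control in used capital goods as an element of `L²`. -/
def optLp : State sbar := D.memLp_optDistributed.toLp

lemma optLp_coeFn : D.optLp =ᵐ[ageMeasure sbar] optDistributed sbar mu c :=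
  D.memLp_optDistributed.coeFn_toLp

/-- The first-order condition 2β₁u₁* = ᾱ - q₁, in operator form. -/
lemma two_smul_M_optLp : (2 : ℝ) • D.M D.optLp = D.alphaBarLp - D.memLp_q1.toLp := by
  apply Lp.ext
  filter_upwards [Lp.coeFn_smul (2 : ℝ) (D.M D.optLp), D.M_coeFn D.optLp, D.optLp_coeFn,
    Lp.coeFn_sub D.alphaBarLp D.memLp_q1.toLp, D.alphaBarLp_coeFn, D.memLp_q1.coeFn_toLp,
    D.le_beta1] with s h1 h2 h3 h4 h5 h6 h7
  have := D.ε_pos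
  have : c.β1 s ≠ 0 := by linarith
  rw [h1, h4, Pi.smul_apply, Pi.sub_apply, h2, h3, h5, h6, optDistributed, smul_eq_mul]
  field_simp

/-- The loss of a control with respect to the optimal one. -/
def loss (u : ℝ × State sbar) : ℝ :=
  c.β0 * (u.1 - optBoundary sbar mu c) ^ 2 + inner ℝ (D.M (u.2 - D.optLp)) (u.2 - D.optLp)

lemma beta0_pos : 0 < c.β0 := D.ε_pos.trans_le D.le_beta0

lemma loss_nonneg (u : ℝ × State sbar) : 0 ≤ D.loss u := by
  have h1 := D.le_inner_M (u.2 - D.optLp)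
  have h2 := mul_nonneg D.ε_pos.le (sq_nonneg ‖u.2 - D.optLp‖)
  have h3 := mul_nonneg D.beta0_pos.le (sq_nonneg (u.1 - optBoundary sbar mu c))
  rw [loss]
  linarith

lemma eq_of_loss_eq_zero {u : ℝ × State sbar} (h : D.loss u = 0) :
    u = (optBoundary sbar mu c, D.optLp) := by
  have h1 := D.le_inner_M (u.2 - D.optLp)
  have h2 := mul_nonneg D.ε_pos.le (sq_nonneg ‖u.2 - D.optLp‖)
  have h3 := mul_nonneg D.beta0_pos.le (sq_nonneg (u.1 - optBoundary sbar mu c))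
  rw [loss] at h
  have e1 : c.β0 * (u.1 - optBoundary sbar mu c) ^ 2 = 0 := by linarith
  have e2 : D.ε * ‖u.2 - D.optLp‖ ^ 2 = 0 := by linarith
  have e1' := pow_eq_zero_iff (two_ne_zero) |>.1 ((mul_eq_zero.1 e1).resolve_left D.beta0_pos.ne')
  have e2' := pow_eq_zero_iff (two_ne_zero) |>.1 ((mul_eq_zero.1 e2).resolve_left D.ε_pos.ne')
  exact Prod.ext (sub_eq_zero.1 e1') (sub_eq_zero.1 (norm_eq_zero.1 e2'))

lemma continuous_loss : Continuous D.loss := by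
  refine ((continuous_const.mul ((continuous_fst.sub continuous_const).pow 2))).add ?_
  exact Continuous.inner (D.M.continuous.comp (continuous_snd.sub continuous_const))
    (continuous_snd.sub continuous_const)

/-- A quadratic bound from (a - b)² ≤ 2a² + 2b²; it makes the discounted loss of an admissible
control integrable. -/
lemma loss_le (u : ℝ × State sbar) :
    D.loss u ≤ 2 * (c.β0 + ‖D.M‖) * (|u.1| + ‖u.2‖) ^ 2 +
      2 * (c.β0 * optBoundary sbar mu c ^ 2 + ‖D.M‖ * ‖D.optLp‖ ^ 2) := by
  have hβ := D.beta0_pos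
  have hM := norm_nonneg D.M
  have h0 : inner ℝ (D.M (u.2 - D.optLp)) (u.2 - D.optLp) ≤ ‖D.M‖ * ‖u.2 - D.optLp‖ ^ 2 := by
    refine (real_inner_le_norm _ _).trans ?_
    rw [pow_two, ← mul_assoc]
    gcongr
    exact D.M.le_opNorm _
  have h1 : ‖u.2 - D.optLp‖ ^ 2 ≤ 2 * (|u.1| + ‖u.2‖) ^ 2 + 2 * ‖D.optLp‖ ^ 2 := by
    have a := norm_sub_le u.2 D.optLp
    have b : ‖u.2 - D.optLp‖ ^ 2 ≤ (‖u.2‖ + ‖D.optLp‖) ^ 2 := by gcongr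
    nlinarith [sq_nonneg (‖u.2‖ - ‖D.optLp‖), mul_nonneg (abs_nonneg u.1) (norm_nonneg u.2),
      sq_nonneg |u.1|]
  have h2 : (u.1 - optBoundary sbar mu c) ^ 2 ≤
      2 * (|u.1| + ‖u.2‖) ^ 2 + 2 * optBoundary sbar mu c ^ 2 := by
    nlinarith [sq_nonneg (u.1 + optBoundary sbar mu c), mul_nonneg (abs_nonneg u.1) (norm_nonneg u.2),
      sq_abs u.1, sq_nonneg ‖u.2‖]
  rw [loss]
  nlinarith [mul_le_mul_of_nonneg_left h1 hM, mul_le_mul_of_nonneg_left h2 hβ.le]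

lemma integrableOn_loss {u : ℝ → ℝ × State sbar} (hu : Admissible sbar c.ρ u) :
    IntegrableOn (fun t => Real.exp (-c.ρ * t) * D.loss (u t)) (Ioi 0) := by
  refine Integrable.mono' ((hu.2.const_mul (2 * (c.β0 + ‖D.M‖))).add
    ((exp_neg_integrableOn_Ioi 0 D.rho_pos).mul_const
      (2 * (c.β0 * optBoundary sbar mu c ^ 2 + ‖D.M‖ * ‖D.optLp‖ ^ 2)))) ?_ ?_
  · exact (by fun_prop : Continuous fun t : ℝ => Real.exp (-c.ρ * t)).aestronglyMeasurable.mul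
      (D.continuous_loss.comp_aestronglyMeasurable hu.1)
  · refine Eventually.of_forall fun t => ?_
    rw [Real.norm_eq_abs, abs_of_nonneg (mul_nonneg (Real.exp_pos _).le (D.loss_nonneg _)),
      Pi.add_apply]
    nlinarith [mul_le_mul_of_nonneg_left (D.loss_le (u t)) (Real.exp_pos (-c.ρ * t)).le]

/-! ### The profit -/

lemma integrable_profitDensity (x w : State sbar) :
    Integrable (profitDensity c x w) (ageMeasure sbar) :=
  ((D.memLp_alpha.integrable_mul (Lp.memLp x)).sub
    (D.memLp_q1.integrable_mul (Lp.memLp w))).sub (D.integrable_beta1_sq w)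

/-- The maximal profit rate of a control, where the revenue is replaced by its present value. -/
def maxRate : ℝ := c.β0 * optBoundary sbar mu c ^ 2 + inner ℝ (D.M D.optLp) D.optLp

/-- Completion of the square: pairing minus control costs is `maxRate` minus `loss`. In the proof,
`h2` and `h3` are the first-order conditions that eliminate q₁ and q₀. -/
lemma profitRate_eq (x : State sbar) (u : ℝ × State sbar) :
    profitRate c x u = inner ℝ x D.memLp_alpha.toLp -
      pairing sbar u (∫ r, revenueKernel (c.ρ + mu) D.memLp_alpha r) + D.maxRate - D.loss u := by
  have h1 : ∫ s, profitDensity c x u.2 s ∂(ageMeasure sbar) =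
      inner ℝ x D.memLp_alpha.toLp - inner ℝ u.2 D.memLp_q1.toLp - inner ℝ (D.M u.2) u.2 := by
    have ha := D.memLp_alpha.integrable_mul (Lp.memLp x)
    have hq := D.memLp_q1.integrable_mul (Lp.memLp u.2)
    have e := integral_sub (ha.sub hq) (D.integrable_beta1_sq u.2)
    rw [integral_sub' ha hq] at e
    refine e.trans ?_
    rw [← integral_mul_eq_inner, ← integral_mul_eq_inner, D.inner_M]
    simp only [Pi.mul_apply, mul_comm, pow_two, mul_assoc]
  have h2 : inner ℝ u.2 D.alphaBarLp =
      inner ℝ u.2 D.memLp_q1.toLp + 2 * inner ℝ (D.M D.optLp) u.2 := by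
    rw [← real_inner_smul_left, D.two_smul_M_optLp, inner_sub_left,
      real_inner_comm u.2 D.alphaBarLp, real_inner_comm u.2 D.memLp_q1.toLp]
    ring
  have h3 : (∫ r, revenueKernel (c.ρ + mu) D.memLp_alpha r).1 =
      c.q0 + 2 * c.β0 * optBoundary sbar mu c := by
    rw [fst_integral_revenueKernel D.rate_pos, optBoundary]
    have := D.beta0_pos.ne'
    field_simp
    ring
  have h4 : inner ℝ (D.M (u.2 - D.optLp)) (u.2 - D.optLp) =
      inner ℝ (D.M u.2) u.2 - 2 * inner ℝ (D.M D.optLp) u.2 + inner ℝ (D.M D.optLp) D.optLp := by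
    rw [map_sub, inner_sub_left, inner_sub_right, inner_sub_right, D.inner_M_comm u.2 D.optLp]
    ring
  rw [profitRate, h1, pairing_apply, h3, maxRate, loss, h4, ← alphaBarLp, h2]
  ring

/-- By the definition of u*, β(u*)²/ρ = (ᾱ - q)²/(4ρβ) in each component. -/
lemma explicitValue_eq (x : State sbar) :
    explicitValue sbar mu c x = inner ℝ x D.alphaBarLp + D.maxRate / c.ρ := by
  have hβ := D.beta0_pos.ne'
  have hρ := D.rho_pos.ne'
  have h1 : ∫ s, alphaBar sbar mu c s * x s ∂(ageMeasure sbar) = inner ℝ x D.alphaBarLp := by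
    rw [L2.inner_def]
    refine integral_congr_ae ?_
    filter_upwards [D.alphaBarLp_coeFn] with s hs
    simp [hs]
  have h2 : ∫ s, (alphaBar sbar mu c s - c.q1 s) ^ 2 / (4 * c.ρ * c.β1 s) ∂(ageMeasure sbar) =
      inner ℝ (D.M D.optLp) D.optLp / c.ρ := by
    rw [D.inner_M, ← integral_div]
    refine integral_congr_ae ?_
    filter_upwards [D.optLp_coeFn, D.le_beta1] with s h1 h2
    have := D.ε_pos
    have : c.β1 s ≠ 0 := by linarith
    rw [h1, optDistributed]
    field_simp
    ring
  rw [explicitValue, h1, h2, maxRate, optBoundary]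
  field_simp
  ring

/-- The fundamental identity. By duality the discounted revenue minus the discounted pairing is ⟨x,
ᾱ⟩, and ∫ e^{-ρt} dt = 1/ρ turns `maxRate` into the constant part of v. -/
theorem payoff_eq {x : State sbar} {u : ℝ → ℝ × State sbar} (hu : Admissible sbar c.ρ u)
    {y : ℝ → State sbar} (hy : IsMildSolution sbar mu x u y) :
    PayoffFinite c y u ∧ payoff c y u = explicitValue sbar mu c x -
      ∫ t in Ioi 0, Real.exp (-c.ρ * t) * D.loss (u t) := by
  obtain ⟨hR, eR⟩ := integral_discounted_revenue D.rho_pos D.rate_pos hu hy D.memLp_alpha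
    D.domAdjoint_alpha
  set k := ∫ r, revenueKernel (c.ρ + mu) D.memLp_alpha r with hk
  have hP : IntegrableOn (fun t => Real.exp (-c.ρ * t) * pairing sbar (u t) k) (Ioi 0) := by
    refine (((pairing sbar).flip k).integrable_comp (hu.integrableOn_discounted D.rho_pos)).congr
      (Eventually.of_forall fun t => ?_)
    simp only [ContinuousLinearMap.flip_apply, map_smul, smul_eq_mul]
  have hE : IntegrableOn (fun t => Real.exp (-c.ρ * t) * D.maxRate) (Ioi 0) :=
    (exp_neg_integrableOn_Ioi 0 D.rho_pos).mul_const _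
  have hL := D.integrableOn_loss hu
  have heq : (fun t => Real.exp (-c.ρ * t) * profitRate c (y t) (u t)) =
      (((fun t => Real.exp (-c.ρ * t) * inner ℝ (y t) D.memLp_alpha.toLp) -
        fun t => Real.exp (-c.ρ * t) * pairing sbar (u t) k) +
        fun t => Real.exp (-c.ρ * t) * D.maxRate) -
        fun t => Real.exp (-c.ρ * t) * D.loss (u t) := by
    ext t
    simp only [Pi.sub_apply, Pi.add_apply]
    rw [D.profitRate_eq]
    ring
  refine ⟨⟨fun t _ => D.integrable_profitDensity _ _, ?_⟩, ?_⟩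
  · rw [heq]
    exact ((hR.sub hP).add hE).sub hL
  · have hexp : ∫ t in Ioi (0 : ℝ), Real.exp (-c.ρ * t) = 1 / c.ρ := by
      rw [integral_exp_mul_Ioi (neg_lt_zero.2 D.rho_pos)]
      simp
    rw [payoff, heq, integral_sub' ((hR.sub hP).add hE) hL, integral_add' (hR.sub hP) hE,
      integral_sub' hR hP, eR, integral_mul_const, hexp, D.explicitValue_eq, alphaBarLp]
    ring

/-! ### The value function and the optimal control -/

lemma admissible_const (w : ℝ × State sbar) : Admissible sbar c.ρ fun _ => w :=
  ⟨aestronglyMeasurable_const, (exp_neg_integrableOn_Ioi 0 D.rho_pos).mul_const _⟩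

lemma exists_mildSolution (x : State sbar) {u : ℝ → ℝ × State sbar}
    (hu : Admissible sbar c.ρ u) : ∃ y, IsMildSolution sbar mu x u y :=
  ⟨_, isMildSolution_mildSolution mu x (hu.locallyAdmissible D.rho_pos)⟩

lemma payoff_opt {x : State sbar} {y : ℝ → State sbar}
    (hy : IsMildSolution sbar mu x (fun _ => (optBoundary sbar mu c, D.optLp)) y) :
    payoff c y (fun _ => (optBoundary sbar mu c, D.optLp)) = explicitValue sbar mu c x := by
  rw [(D.payoff_eq (D.admissible_const _) hy).2]
  simp [loss]

theorem valueFunction_eq (x : State sbar) :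
    valueFunction sbar mu c x = ((explicitValue sbar mu c x : ℝ) : EReal) := by
  refine le_antisymm (sSup_le ?_) (le_sSup ?_)
  · rintro r ⟨u, y, hu, hy, rfl⟩
    rw [(D.payoff_eq hu hy).2, EReal.coe_le_coe_iff]
    refine sub_le_self _ (integral_nonneg fun t => ?_)
    exact mul_nonneg (Real.exp_pos _).le (D.loss_nonneg _)
  · obtain ⟨y, hy⟩ := D.exists_mildSolution x (D.admissible_const (optBoundary sbar mu c, D.optLp))
    exact ⟨_, y, D.admissible_const _, hy, by rw [D.payoff_opt hy]⟩

theorem isOptimal_opt (x : State sbar) :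
    IsOptimal sbar mu c x fun _ => (optBoundary sbar mu c, D.optLp) := by
  obtain ⟨y, hy⟩ := D.exists_mildSolution x (D.admissible_const (optBoundary sbar mu c, D.optLp))
  exact ⟨D.admissible_const _, y, hy, by rw [D.payoff_opt hy, D.valueFunction_eq]⟩

/-- An optimal control has zero integrated loss; the integrand being nonnegative, the loss vanishes
at almost every time. -/
theorem ae_eq_of_isOptimal {x : State sbar} {u : ℝ → ℝ × State sbar}
    (h : IsOptimal sbar mu c x u) :
    ∀ᵐ t ∂(volume.restrict (Ioi (0 : ℝ))), u t = (optBoundary sbar mu c, D.optLp) := by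
  obtain ⟨hu, y, hy, e⟩ := h
  rw [D.valueFunction_eq, EReal.coe_eq_coe_iff, (D.payoff_eq hu hy).2] at e
  have e0 : ∫ t in Ioi 0, Real.exp (-c.ρ * t) * D.loss (u t) = 0 := by linarith
  rw [integral_eq_zero_iff_of_nonneg
    (fun t => mul_nonneg (Real.exp_pos _).le (D.loss_nonneg _)) (D.integrableOn_loss hu)] at e0
  filter_upwards [e0] with t ht
  exact D.eq_of_loss_eq_zero ((mul_eq_zero.1 ht).resolve_left (Real.exp_pos _).ne')

end ProblemData

/-! ### The trajectory of a constant control -/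

/-- Substitution σ = t - τ: for a constant control the elapsed time σ is the natural variable. -/
lemma duhamel_const {sbar : EReal} (mu t b : ℝ) (w : State sbar)
    (hu : LocallyAdmissible fun _ : ℝ => (b, w)) (ht : 0 ≤ t) :
    Real.exp (-mu * t) • restrictAge sbar
        (translate t (∫ τ in (0 : ℝ)..t, duhamelIntegrand mu (fun _ => (b, w)) τ)) =
      ∫ σ in (0 : ℝ)..t, Real.exp (-mu * σ) • ageShift sbar σ w := by
  have hint : IntervalIntegrable (duhamelIntegrand mu fun _ => (b, w)) volume 0 t :=
    (intervalIntegrable_iff_integrableOn_Ioc_of_le ht).2 (integrableOn_duhamelIntegrand mu hu t)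
  have e := (restrictAge sbar ∘L translate t).intervalIntegral_comp_comm hint
  rw [ContinuousLinearMap.comp_apply] at e
  rw [← e, ← intervalIntegral.integral_smul]
  have e2 := intervalIntegral.integral_comp_sub_left (a := 0) (b := t)
    (fun σ => Real.exp (-mu * σ) • ageShift sbar σ w) t
  rw [sub_self, sub_zero] at e2
  rw [← e2]
  refine intervalIntegral.integral_congr fun τ _ => ?_
  simp only [duhamelIntegrand, ContinuousLinearMap.comp_apply, map_smul, smul_smul,
    translate_translate, ageShift_apply]
  rw [← Real.exp_add, ← sub_eq_add_neg]
  congr 2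
  ring

lemma duhamel_const_coeFn {sbar : EReal} (mu : ℝ) {t : ℝ} (ht : 0 ≤ t) {f : ℝ → ℝ}
    (hf : MemLp f 2 (ageMeasure sbar)) :
    (∫ σ in (0 : ℝ)..t, Real.exp (-mu * σ) • ageShift sbar σ hf.toLp : State sbar)
      =ᵐ[ageMeasure sbar]
      fun s => ∫ σ in Ioc 0 t, Real.exp (-mu * σ) * (ageSet sbar).indicator f (s - σ) := by
  have hc : Continuous fun σ : ℝ => Real.exp (-mu * σ) • ageShift sbar σ hf.toLp :=
    (Real.continuous_exp.comp (continuous_const.mul continuous_id)).smul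
      ((continuous_ageShift sbar).comp (continuous_id.prodMk continuous_const))
  have hq : Measure.QuasiMeasurePreserving (fun p : ℝ × ℝ => p.2 - p.1)
      (volume.prod volume) volume :=
    (quasiMeasurePreserving_sub_of_right_invariant (volume : Measure ℝ) (volume : Measure ℝ)).comp
      (Measure.measurePreserving_swap (μ := (volume : Measure ℝ))
        (ν := (volume : Measure ℝ))).quasiMeasurePreserving
  rw [intervalIntegral.integral_of_le ht]
  refine coeFn_integral_Lp (m := ageMeasure sbar) (ν := volume.restrict (Ioc 0 t))
    ((hc.integrableOn_Icc (a := 0) (b := t)).mono_set Ioc_subset_Icc_self)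
    (g := fun σ s => Real.exp (-mu * σ) * (ageSet sbar).indicator f (s - σ))
    ((by fun_prop : Continuous fun p : ℝ × ℝ =>
      Real.exp (-mu * p.1)).aestronglyMeasurable.mul
      (aestronglyMeasurable_indicator_comp hf.1 hq _ _))
    (Eventually.of_forall fun σ => ?_)
  filter_upwards [Lp.coeFn_smul (Real.exp (-mu * σ)) (ageShift sbar σ hf.toLp),
    ageShift_toLp_coeFn σ hf] with s h1 h2
  rw [h1, Pi.smul_apply, h2, smul_eq_mul]

theorem mildSolution_const_coeFn {sbar : EReal} {mu : ℝ} {c : Coeffs} (x : State sbar)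
    (h : MemLp (optDistributed sbar mu c) 2 (ageMeasure sbar))
    (hu : LocallyAdmissible fun _ : ℝ => (optBoundary sbar mu c, h.toLp)) {t : ℝ} (ht : 0 ≤ t) :
    mildSolution mu x hu t =ᵐ[ageMeasure sbar] optTrajectory sbar mu c x t := by
  have e : mildSolution mu x hu t = Real.exp (-mu * t) • ageShift sbar t x +
      Real.exp (-mu * t) •
        restrictAge sbar (translate t (memLp_boundaryProfile mu (hu.fst t)).toLp) +
      ∫ σ in (0 : ℝ)..t, Real.exp (-mu * σ) • ageShift sbar σ h.toLp := by
    rw [← duhamel_const mu t _ _ hu ht, mildSolution, map_add, map_add, map_add, map_add, smul_add,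
      smul_add, ageShift_apply]
  have hm : ∀ᵐ s ∂(ageMeasure sbar), s ∈ ageSet sbar :=
    ae_restrict_mem (measurableSet_ageSet sbar)
  have hne : ∀ᵐ s ∂(ageMeasure sbar), s ≠ t :=
    ae_restrict_of_ae (by simp [ae_iff, measure_singleton])
  rw [e]
  set A := ageShift sbar t x
  set B := restrictAge sbar (translate t (memLp_boundaryProfile mu (hu.fst t)).toLp)
  set C := ∫ σ in (0 : ℝ)..t, Real.exp (-mu * σ) • ageShift sbar σ h.toLp
  filter_upwards [Lp.coeFn_add (Real.exp (-mu * t) • A + Real.exp (-mu * t) • B) C,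
    Lp.coeFn_add (Real.exp (-mu * t) • A) (Real.exp (-mu * t) • B),
    Lp.coeFn_smul (Real.exp (-mu * t)) A, Lp.coeFn_smul (Real.exp (-mu * t)) B,
    ageShift_coeFn t x, restrictAge_translate_boundaryProfile_coeFn sbar mu t (hu.fst t),
    duhamel_const_coeFn mu ht h, hm, hne] with s h1 h2 h3 h4 h5 h6 h7 hs hst
  rw [h1, Pi.add_apply, h2, Pi.add_apply, h3, h4, Pi.smul_apply, Pi.smul_apply, h5, h6, h7,
    optTrajectory, smul_eq_mul, smul_eq_mul]
  have hsub : ∀ σ, 0 ≤ σ → σ < s → s - σ ∈ ageSet sbar := fun σ h0 h1 =>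
    ⟨sub_pos.2 h1, (EReal.coe_le_coe (by linarith)).trans_lt hs.2⟩
  rcases lt_or_gt_of_ne hst with hlt | hlt
  -- Ages s < t: the capital was bought after time 0, so the initial datum does not contribute and
  -- the boundary profile does.
  · rw [if_neg (not_le.2 hlt), indicator_of_notMem (fun h => by have := h.1; linarith),
      boundaryProfile,
      indicator_of_mem (show s - t ∈ Ioo (-t) 0 from ⟨by linarith [hs.1], by linarith⟩),
      mul_zero, zero_add, ← mul_assoc, ← Real.exp_add,
      intervalIntegral.integral_of_le hs.1.le, integral_Ioc_eq_integral_Ioo (y := s)]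
    congr 1
    · ring_nf
    -- For s ≤ σ ≤ t the shifted age s - σ is not positive, and the integrand vanishes.
    · rw [setIntegral_eq_of_subset_of_forall_sdiff_eq_zero measurableSet_Ioc
        (show Ioo 0 s ⊆ Ioc 0 t from fun σ hσ => ⟨hσ.1, by linarith [hσ.2]⟩)]
      · refine setIntegral_congr_fun measurableSet_Ioo fun σ hσ => ?_
        simp only [indicator_of_mem (hsub σ hσ.1.le hσ.2)]
      · intro σ hσ
        rw [indicator_of_notMem, mul_zero]
        intro h'
        exact hσ.2 ⟨hσ.1.1, by linarith [h'.1]⟩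
  -- Ages s > t: the capital predates time 0, and s - t > 0 lies outside the boundary profile.
  · rw [if_pos hlt.le, indicator_of_mem (hsub t ht hlt), boundaryProfile,
      indicator_of_notMem (fun h => by have := h.2; linarith), mul_zero, add_zero,
      intervalIntegral.integral_of_le ht]
    congr 1
    refine setIntegral_congr_fun measurableSet_Ioc fun σ hσ => ?_
    simp only [indicator_of_mem (hsub σ hσ.1.le (hσ.2.trans_lt hlt))]

end VintageCapital

end

theorem mainTheorem11 (sbar : EReal) (hsbar : 0 < sbar) (mu : ℝ) (c : VintageCapital.Coeffs)
    (hρ : 0 < c.ρ) (hc : VintageCapital.CoeffAssumption sbar c)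
    (hmu : sbar = ⊤ → -mu < c.ρ) :
    -- the control problem is well posed
    (∀ (x : VintageCapital.State sbar) (u : ℝ → ℝ × VintageCapital.State sbar),
      VintageCapital.Admissible sbar c.ρ u →
        ∃ y, VintageCapital.IsMildSolution sbar mu x u y ∧
          (∀ y', VintageCapital.IsMildSolution sbar mu x u y' → Set.EqOn y' y (Set.Ici 0)) ∧
          VintageCapital.PayoffFinite c y u) ∧
    -- the value function is the explicit function `v`
    (∀ x : VintageCapital.State sbar,
      VintageCapital.valueFunction sbar mu c x =
        ((VintageCapital.explicitValue sbar mu c x : ℝ) : EReal)) ∧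
    -- the unique optimal control and the optimal trajectory
    ∃ h : MeasureTheory.MemLp (VintageCapital.optDistributed sbar mu c) 2
        (VintageCapital.ageMeasure sbar),
      ∀ x : VintageCapital.State sbar,
        VintageCapital.IsOptimal sbar mu c x
          (fun _ => (VintageCapital.optBoundary sbar mu c, h.toLp)) ∧
        (∀ u, VintageCapital.IsOptimal sbar mu c x u →
          ∀ᵐ t ∂(MeasureTheory.volume.restrict (Set.Ioi (0 : ℝ))),
            u t = (VintageCapital.optBoundary sbar mu c, h.toLp)) ∧
        ∀ y, VintageCapital.IsMildSolution sbar mu x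
            (fun _ => (VintageCapital.optBoundary sbar mu c, h.toLp)) y →
          ∀ t : ℝ, 0 ≤ t →
            ∀ᵐ s ∂(VintageCapital.ageMeasure sbar),
              y t s = VintageCapital.optTrajectory sbar mu c (fun r => x r) t s := by
  obtain ⟨D⟩ := hc.nonempty_problemData hsbar hρ hmu
  refine ⟨fun x u hu => ?_, D.valueFunction_eq, D.memLp_optDistributed, fun x => ⟨?_, ?_, ?_⟩⟩
  · obtain ⟨y, hy⟩ := D.exists_mildSolution x hu
    exact ⟨y, hy, fun y' hy' => hy.eqOn hy', (D.payoff_eq hu hy).1⟩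
  · exact D.isOptimal_opt x
  · exact fun u hu => D.ae_eq_of_isOptimal hu
  · intro y hy t ht
    have hu := (D.admissible_const (VintageCapital.optBoundary sbar mu c,
      D.memLp_optDistributed.toLp)).locallyAdmissible D.rho_pos
    -- Uniqueness allows the given trajectory to be replaced by the constructed one.
    rw [(VintageCapital.isMildSolution_mildSolution mu x hu).eqOn hy ht]
    exact VintageCapital.mildSolution_const_coeFn x D.memLp_optDistributed hu ht
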